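/- Identify $\mathbb{R}^8$ with $\mathbb{H}^2$, and let $\mathbb{S}^7=\{(x,y)\in\mathbb{H}^2:\|x\|^2+\|y\|^2=1\}$. A distribution on $\mathbb{S}^7$ is always endowed with the restriction of the standard Riemannian metric. Let $\mathbb{S}^7_Q$ (the quaternionic contact structure) be $\mathbb{S}^7$ with the rank-$4$ distribution whose fibre at $q$ is the orthogonal complement in $T_q\mathbb{S}^7$ of $q\mathbf{i},q\mathbf{j},q\mathbf{k}$. Let $\mathbb{S}^7_T$ (the trivializable structure) be $\mathbb{S}^7$ with the rank-$4$ distribution spanned at $z=(x,y)$ by $A_1z,\dots,A_4z$, where $A_l(x,y)=(B_ly,B_lx)$ for $l=1,2,3$, with $B_1,B_2,B_3$ the right multiplications by $\mathbf{k},\mathbf{j},-\mathbf{i}$ on $\mathbb{H}$, and $A_4(x,y)=(y,-x)$. A subriemannian isometry is a diffeomorphism whose differential maps each horizontal space isometrically onto the horizontal space at the image point. The nilpotent approximation (tangent algebra) at $q$ of a distribution $\mathcal{H}$ with fibre inner product $\langle\cdot,\cdot\rangle$ is $\mathcal{H}_q\oplus(\mathcal{H}^2_q/\mathcal{H}_q)$,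 where $\mathcal{H}^2=\mathcal{H}+[\mathcal{H},\mathcal{H}]$, with the bracket $\mathcal{H}_q\times\mathcal{H}_q\to\mathcal{H}^2_q/\mathcal{H}_q$ induced by the Lie bracket of horizontal vector fields and with all other brackets zero. It is nonsingular if for every nonzero $Z\in(\mathcal{H}^2_q/\mathcal{H}_q)^*$ the linear map $J_Z:\mathcal{H}_q\to\mathcal{H}_q$ given by $\langle J_Zu,v\rangle=Z([u,v])$ is invertible, and singular otherwise. **Theorem.** 1. $\mathbb{S}^7_Q$ and $\mathbb{S}^7_T$ are not locally isometric: no nonempty open subset of $\mathbb{S}^7_Q$ is subriemannian isometric, by a smooth diffeomorphism, to an open subset of $\mathbb{S}^7_T$. 2. The group of all smooth subriemannian isometries of $\mathbb{S}^7_T$ does not act transitively on $\mathbb{S}^7$. 3. The nilpotent approximation of $\mathbb{S}^7_T$ at $(x,y)\in\mathbb{S}^7$ is nonsingular if and only if $\|x\|\neq\|y\|$, while the nilpotent approximation of $\mathbb{S}^7_Q$ is nonsingular at every point of $\mathbb{S}^7$. -/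

import Mathlib

open scoped Manifold ContDiff
open VectorField

noncomputable section

/-! ### Distributions with a fibre inner product, isometries, nilpotent approximation -/

/-- A distribution on the manifold `M` together with an inner product on each of its fibres. -/
structure SubriemannianStructure {E : Type*} [NormedAddCommGroup E] [NormedSpace ℝ E]
    {H : Type*} [TopologicalSpace H] (I : ModelWithCorners ℝ E H)
    (M : Type*) [TopologicalSpace M] [ChartedSpace H M] where
  /-- The fibre at `q` of the horizontal distribution. -/
  horizontal : ∀ q : M, Submodule ℝ (TangentSpace I q)
  /-- The inner product on the fibre at `q`. -/
  metric : ∀ q : M, horizontal q →ₗ[ℝ] horizontal q →ₗ[ℝ] ℝ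
  metric_symm : ∀ (q : M) (u v : horizontal q), metric q u v = metric q v u
  metric_pos : ∀ (q : M) (u : horizontal q), u ≠ 0 → 0 < metric q u u

namespace SubriemannianStructure

variable {E : Type*} [NormedAddCommGroup E] [NormedSpace ℝ E]
  {H : Type*} [TopologicalSpace H] {I : ModelWithCorners ℝ E H}
  {M : Type*} [TopologicalSpace M] [ChartedSpace H M]
  {E' : Type*} [NormedAddCommGroup E'] [NormedSpace ℝ E']
  {H' : Type*} [TopologicalSpace H'] {I' : ModelWithCorners ℝ E' H'}
  {M' : Type*} [TopologicalSpace M'] [ChartedSpace H' M']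

/-- The differential of `φ` at `q` maps the horizontal space at `q` isometrically onto the
horizontal space at `φ q`. -/
structure IsIsometryAt (S : SubriemannianStructure I M) (S' : SubriemannianStructure I' M')
    (φ : M → M') (q : M) : Prop where
  map_horizontal : (S.horizontal q).map (mfderiv I I' φ q).toLinearMap = S'.horizontal (φ q)
  map_metric : ∀ (u v : S.horizontal q) (u' v' : S'.horizontal (φ q)),
    (u' : TangentSpace I' (φ q)) = mfderiv I I' φ q (u : TangentSpace I q) →
    (v' : TangentSpace I' (φ q)) = mfderiv I I' φ q (v : TangentSpace I q) →
    S'.metric (φ q) u' v' = S.metric q u v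

/-- Some nonempty open subset of `M` is mapped onto an open subset of `M'` by a subriemannian
isometry, that is, by a smooth diffeomorphism which is an isometry of the structures at each
point. -/
def SomewhereLocallyIsometric (S : SubriemannianStructure I M)
    (S' : SubriemannianStructure I' M') : Prop :=
  ∃ φ : PartialDiffeomorph I I' M M' ∞, φ.source.Nonempty ∧
    ∀ q ∈ φ.source, S.IsIsometryAt S' φ q

theorem IsIsometryAt.refl (S : SubriemannianStructure I M) (q : M) :
    S.IsIsometryAt S id q := by
  constructor
  · simp [mfderiv_id]
  · intro u v u' v' hu hv
    have h1 : u' = u := Subtype.ext (by simpa [mfderiv_id] using hu)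
    have h2 : v' = v := Subtype.ext (by simpa [mfderiv_id] using hv)
    rw [h1, h2]
    rfl

theorem IsIsometryAt.comp {S : SubriemannianStructure I M} {φ ψ : M → M} {q : M}
    (hψ : S.IsIsometryAt S ψ (φ q)) (hφ : S.IsIsometryAt S φ q)
    (dψ : MDifferentiableAt I I ψ (φ q)) (dφ : MDifferentiableAt I I φ q) :
    S.IsIsometryAt S (ψ ∘ φ) q := by
  have hc := mfderiv_comp q dψ dφ
  constructor
  · rw [hc]
    change Submodule.map ((mfderiv I I ψ (φ q)).toLinearMap ∘ₗ (mfderiv I I φ q).toLinearMap) _ = _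
    rw [Submodule.map_comp, hφ.map_horizontal, hψ.map_horizontal]
    rfl
  · intro u v u' v' hu hv
    rw [hc] at hu hv
    have key : ∀ w : S.horizontal q,
        mfderiv I I φ q (w : TangentSpace I q) ∈ S.horizontal (φ q) := fun w => by
      rw [← hφ.map_horizontal]
      exact Submodule.mem_map_of_mem w.2
    rw [← hφ.map_metric u v ⟨_, key u⟩ ⟨_, key v⟩ rfl rfl]
    exact hψ.map_metric ⟨_, key u⟩ ⟨_, key v⟩ u' v' hu hv

theorem IsIsometryAt.symm {S : SubriemannianStructure I M} (Φ : M ≃ₘ^∞⟮I, I⟯ M)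
    (h : ∀ q, S.IsIsometryAt S Φ q) (q : M) : S.IsIsometryAt S Φ.symm q := by
  have d1 : MDifferentiableAt I I Φ (Φ.symm q) := Φ.contMDiff.mdifferentiable (by simp) _
  have d2 : MDifferentiableAt I I Φ.symm q := Φ.symm.contMDiff.mdifferentiable (by simp) _
  have hpq : Φ (Φ.symm q) = q := Φ.apply_symm_apply q
  have d3 : MDifferentiableAt I I Φ.symm (Φ (Φ.symm q)) := by rw [hpq]; exact d2
  have e1 : (mfderiv I I Φ (Φ.symm q)).comp (mfderiv I I Φ.symm q)
      = ContinuousLinearMap.id ℝ (TangentSpace I q) := by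
    have hc := mfderiv_comp q d1 d2
    have hid : (Φ ∘ Φ.symm : M → M) = id := funext Φ.apply_symm_apply
    rw [hid, mfderiv_id] at hc
    exact hc.symm
  have e2 : (mfderiv I I Φ.symm q).comp (mfderiv I I Φ (Φ.symm q))
      = ContinuousLinearMap.id ℝ (TangentSpace I (Φ.symm q)) := by
    have hc := mfderiv_comp (Φ.symm q) d3 d1
    have hid : (Φ.symm ∘ Φ : M → M) = id := funext Φ.symm_apply_apply
    rw [hid, mfderiv_id, hpq] at hc
    exact hc.symm
  have e1' : ∀ w : TangentSpace I q,
      mfderiv I I Φ (Φ.symm q) (mfderiv I I Φ.symm q w) = w := fun w => DFunLike.congr_fun e1 w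
  have e2' : ∀ w : TangentSpace I (Φ.symm q),
      mfderiv I I Φ.symm q (mfderiv I I Φ (Φ.symm q) w) = w := fun w => DFunLike.congr_fun e2 w
  obtain ⟨hH, hm⟩ := h (Φ.symm q)
  rw [hpq] at hH
  constructor
  · refine le_antisymm ?_ fun w hw => ?_
    · rintro _ ⟨w, hw, rfl⟩
      rw [SetLike.mem_coe, ← hH] at hw
      obtain ⟨v, hv, rfl⟩ := hw
      have := e2' v
      exact this.symm ▸ hv
    · exact ⟨mfderiv I I Φ (Φ.symm q) w, hH ▸ Submodule.mem_map_of_mem hw, e2' w⟩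
  · intro u v u' v' hu hv
    have key : ∀ (r : M), Φ (Φ.symm q) = r → ∀ u v : S.horizontal r,
        @Eq E (u : TangentSpace I r) (mfderiv I I Φ (Φ.symm q) (u' : TangentSpace I (Φ.symm q))) →
        @Eq E (v : TangentSpace I r) (mfderiv I I Φ (Φ.symm q) (v' : TangentSpace I (Φ.symm q))) →
        S.metric r u v = S.metric (Φ.symm q) u' v' := by
      rintro _ rfl u v hu hv
      exact hm u' v' u v hu hv
    refine (key q hpq u v ?_ ?_).symm
    · rw [hu]; exact (e1' u).symm
    · rw [hv]; exact (e1' v).symm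

/-- The group of all subriemannian isometries of `M`, as a group of permutations of `M`. -/
def isometryGroup (S : SubriemannianStructure I M) : Subgroup (Equiv.Perm M) where
  carrier := {e | ∃ Φ : M ≃ₘ^∞⟮I, I⟯ M, Φ.toEquiv = e ∧ ∀ q, S.IsIsometryAt S Φ q}
  mul_mem' := by
    rintro _ _ ⟨Φ, rfl, hΦ⟩ ⟨Ψ, rfl, hΨ⟩
    refine ⟨Ψ.trans Φ, rfl, fun q => ?_⟩
    exact (hΦ (Ψ q)).comp (hΨ q) (Φ.contMDiff.mdifferentiable (by simp) _)
      (Ψ.contMDiff.mdifferentiable (by simp) _)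
  one_mem' := ⟨Diffeomorph.refl I M ∞, rfl, fun q => IsIsometryAt.refl S q⟩
  inv_mem' := by
    rintro _ ⟨Φ, rfl, hΦ⟩
    exact ⟨Φ.symm, rfl, fun q => IsIsometryAt.symm Φ hΦ q⟩

/-- `X` is a smooth horizontal vector field on some open neighbourhood of `q`. -/
def IsHorizontalFieldNear [IsManifold I ∞ M] (S : SubriemannianStructure I M) (q : M)
    (X : ∀ x : M, TangentSpace I x) : Prop :=
  ∃ U : Set M, IsOpen U ∧ q ∈ U ∧
    ContMDiffOn I I.tangent ∞ (fun x => (⟨x, X x⟩ : TangentBundle I M)) U ∧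
    ∀ x ∈ U, X x ∈ S.horizontal x

/-- The fibre at `q` of `𝓗² = 𝓗 + [𝓗, 𝓗]`. -/
def horizontalSq [IsManifold I ∞ M] (S : SubriemannianStructure I M) (q : M) :
    Submodule ℝ (TangentSpace I q) :=
  S.horizontal q ⊔ Submodule.span ℝ {w | ∃ X Y : ∀ x : M, TangentSpace I x,
    S.IsHorizontalFieldNear q X ∧ S.IsHorizontalFieldNear q Y ∧ mlieBracket I X Y q = w}

/-- The second layer `𝓗²_q / 𝓗_q` of the nilpotent approximation at `q`; the first layer is
`𝓗_q`. -/
abbrev secondLayer [IsManifold I ∞ M] (S : SubriemannianStructure I M) (q : M) : Type _ :=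
  S.horizontalSq q ⧸ (S.horizontal q).submoduleOf (S.horizontalSq q)

/-- `β` is induced by the Lie bracket of vector fields: `β (X q) (Y q) = [X, Y] q mod 𝓗_q` for
all smooth horizontal vector fields `X`, `Y` near `q`. -/
def IsTangentBracket [IsManifold I ∞ M] (S : SubriemannianStructure I M) (q : M)
    (β : S.horizontal q →ₗ[ℝ] S.horizontal q →ₗ[ℝ] S.secondLayer q) : Prop :=
  ∀ X Y : ∀ x : M, TangentSpace I x,
    S.IsHorizontalFieldNear q X → S.IsHorizontalFieldNear q Y →
    ∀ (u v : S.horizontal q) (w : S.horizontalSq q),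
      (u : TangentSpace I q) = X q → (v : TangentSpace I q) = Y q →
      (w : TangentSpace I q) = mlieBracket I X Y q →
      β u v = Submodule.Quotient.mk w

open Classical in
/-- The Lie bracket `𝓗_q × 𝓗_q → 𝓗²_q / 𝓗_q` of the nilpotent approximation
`𝓗_q ⊕ 𝓗²_q / 𝓗_q` at `q` (all other components of its Lie bracket vanish). For a smooth
distribution there is exactly one bilinear map induced by the Lie bracket of vector fields. -/
def tangentBracket [IsManifold I ∞ M] (S : SubriemannianStructure I M) (q : M) :
    S.horizontal q →ₗ[ℝ] S.horizontal q →ₗ[ℝ] S.secondLayer q :=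
  if h : ∃ β, S.IsTangentBracket q β then h.choose else 0

/-- The nilpotent approximation at `q` is nonsingular: for every nonzero `Z` in the dual of the
second layer the map `J_Z` of the first layer given by `⟨J_Z u, v⟩ = Z [u, v]` is invertible. -/
def NonsingularAt [IsManifold I ∞ M] (S : SubriemannianStructure I M) (q : M) : Prop :=
  ∀ Z : Module.Dual ℝ (S.secondLayer q), Z ≠ 0 →
    ∃ J : S.horizontal q →ₗ[ℝ] S.horizontal q,
      (∀ u v, S.metric q (J u) v = Z (S.tangentBracket q u v)) ∧ Function.Bijective J

end SubriemannianStructure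

/-! ### The two structures on the seven-sphere -/

/-- `ℍ²` with its Euclidean inner product. -/
abbrev QuaternionPlane : Type := WithLp 2 (Quaternion ℝ × Quaternion ℝ)

instance : Fact (Module.finrank ℝ QuaternionPlane = 7 + 1) :=
  ⟨by
    rw [LinearEquiv.finrank_eq (WithLp.linearEquiv 2 ℝ (Quaternion ℝ × Quaternion ℝ)),
      Module.finrank_prod, Quaternion.finrank_eq_four]⟩

/-- The unit sphere in `ℍ²`. -/
abbrev S7 : Type := Metric.sphere (0 : QuaternionPlane) 1

namespace S7

/-- The differential at `q` of the inclusion of the sphere in `ℍ²`. -/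
def dIncl (q : S7) : TangentSpace (𝓡 7) q →ₗ[ℝ] QuaternionPlane :=
  (mvfderiv (𝓡 7) ((↑) : S7 → QuaternionPlane) q).toLinearMap

theorem dIncl_injective (q : S7) : Function.Injective (dIncl q) :=
  injective_mvfderiv_subtypeVal_sphere q

/-- The distribution on the sphere whose fibre at `q` consists of the tangent vectors lying in the
subspace `V q` of `ℍ²`, with the restriction of the standard Riemannian metric. -/
def inducedStructure (V : S7 → Submodule ℝ QuaternionPlane) :
    SubriemannianStructure (𝓡 7) S7 where
  horizontal q := (V q).comap (dIncl q)
  metric q := ((innerₗ QuaternionPlane).compl₁₂ (dIncl q) (dIncl q)).domRestrict₁₂ _ _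
  metric_symm q u v := real_inner_comm (dIncl q v) (dIncl q u)
  metric_pos q u hu := by
    refine (real_inner_self_pos (F := QuaternionPlane)).2 fun h => hu (Subtype.ext ?_)
    exact dIncl_injective q (by simpa using h)

/-- The imaginary unit `i` of the quaternions. -/
def qi : Quaternion ℝ := ⟨0, 1, 0, 0⟩

/-- The imaginary unit `j` of the quaternions. -/
def qj : Quaternion ℝ := ⟨0, 0, 1, 0⟩

/-- The imaginary unit `k` of the quaternions. -/
def qk : Quaternion ℝ := ⟨0, 0, 0, 1⟩

/-- Right multiplication of both coordinates of `z` by `a`. -/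
def rightMul (a : Quaternion ℝ) (z : QuaternionPlane) : QuaternionPlane :=
  WithLp.toLp 2 (z.fst * a, z.snd * a)

/-- The linear map `(x, y) ↦ (y * b, x * b)`. -/
def crossMul (b : Quaternion ℝ) (z : QuaternionPlane) : QuaternionPlane :=
  WithLp.toLp 2 (z.snd * b, z.fst * b)

/-- The linear map `(x, y) ↦ (y, -x)`. -/
def rot (z : QuaternionPlane) : QuaternionPlane := WithLp.toLp 2 (z.snd, -z.fst)

/-- The quaternionic contact structure: the orthogonal complement in the tangent space of the
directions `q i`, `q j`, `q k` of the fibres of the quaternionic Hopf fibration. -/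
def quaternionic : SubriemannianStructure (𝓡 7) S7 :=
  inducedStructure fun q =>
    (Submodule.span ℝ {rightMul qi (q : QuaternionPlane), rightMul qj (q : QuaternionPlane),
      rightMul qk (q : QuaternionPlane)})ᗮ

/-- The trivializable structure: the span of the Clifford vector fields `z ↦ A_l z`, `l ≤ 4`,
where `A_l (x, y) = (B_l y, B_l x)` for `l ≤ 3`, with `B_1, B_2, B_3` the right multiplications by
`k, j, -i`, and `A_4 (x, y) = (y, -x)`. -/
def trivializable : SubriemannianStructure (𝓡 7) S7 :=
  inducedStructure fun q =>
    Submodule.span ℝ {crossMul qk (q : QuaternionPlane), crossMul qj (q : QuaternionPlane),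
      crossMul (-qi) (q : QuaternionPlane), rot (q : QuaternionPlane)}

end S7

end

/-! A rank-4 distribution on the sphere is studied through the skew forms `⟨ζ, [·, ·]⟩` on a
horizontal space, where `ζ` is tangent to the sphere and orthogonal to that space. Both structures
come from skew linear maps of `ℍ²` that are orthonormal at every point of the sphere
(`IsSkewFrame`): one is the complement of the Hopf frame, the other the span of the Clifford frame.
Differentiating the frame identities in the ambient space gives the bracket modulo the distribution
as an explicit bilinear map (`isCurvatureAt_frameSpan_orthogonal`, `isCurvatureAt_frameSpan`).

For the quaternionic structure `J_Z` is a combination of right multiplications by `i, j, k`, which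
preserve the horizontal space. Hence `J_Z ^ 2` is a scalar, and a nonzero one if `Z ≠ 0`
(`exists_sq_frameOrthogonalCurvature_hopfFrame`).

For the trivializable structure at `p = (x, y)` and `ζ = (ξ, η)`, the matrix of the form in the
Clifford frame has self-dual and anti-self-dual parts given, up to scale, by the vectors `a = Im (x̄
ξ)` and `b = Im (ȳ η)`. Its Pfaffian is `4 (|a|² - |b|²) = 4 (|x|² - |y|²) |ζ|²`
(`pfaffian_cliffordForm`), so singular points are exactly those with `|x| = |y|`. The square of such
a matrix is scalar only if `a` or `b` vanishes, and for the covector `conormal p` neither does once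
`x` and `y` are nonzero (`not_exists_sq_frameCurvature`).

A local isometry transports these forms and the inner product (`exists_linearMap_of_isIsometryAt`).
Scalarity of `J_Z ^ 2` therefore separates the two structures, and nonsingularity separates points
of the trivializable one. -/

noncomputable section

/-! ### The Lie bracket of vector fields as a commutator of derivations -/

section LieBracketDerivation

variable {E : Type*} [NormedAddCommGroup E] [NormedSpace ℝ E] [CompleteSpace E]
  {H : Type*} [TopologicalSpace H] {I : ModelWithCorners ℝ E H} [I.Boundaryless]
  {M : Type*} [TopologicalSpace M] [ChartedSpace H M] [IsManifold I 2 M]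
  {F : Type*} [NormedAddCommGroup F] [NormedSpace ℝ F]

omit [CompleteSpace E] [IsManifold I 2 M] in
theorem mvfderiv_eq_fderiv_extChartAt {f : M → F} {q : M} (hf : MDifferentiableAt I 𝓘(ℝ, F) f q)
    (w : TangentSpace I q) :
    mvfderiv I f q w = fderiv ℝ (f ∘ (extChartAt I q).symm) (extChartAt I q q) w := by
  rw [hf.mvfderiv, I.range_eq_univ, fderivWithin_univ]
  rfl

-- The equality is needed on the whole chart target, not only at the base point, because it is
-- differentiated once more in `mvfderiv_mlieBracket`.
omit [CompleteSpace E] in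
theorem fderiv_comp_extChartAt_symm_mpullbackWithin {f : M → F} (hf : ContMDiff I 𝓘(ℝ, F) 2 f)
    (V : ∀ x : M, TangentSpace I x) {q : M} {y : E} (hy : y ∈ (extChartAt I q).target) :
    fderiv ℝ (f ∘ (extChartAt I q).symm) y
      (mpullbackWithin 𝓘(ℝ, E) I (extChartAt I q).symm V (Set.range I) y) =
    mvfderiv I f ((extChartAt I q).symm y) (V ((extChartAt I q).symm y)) := by
  have hinv := isInvertible_mfderivWithin_extChartAt_symm (I := I) hy
  have hd : MDifferentiableWithinAt 𝓘(ℝ, E) I (extChartAt I q).symm (Set.range I) y :=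
    mdifferentiableWithinAt_of_isInvertible_mfderivWithin hinv
  have hc := mfderiv_comp_mfderivWithin (I := 𝓘(ℝ, E)) (I' := I) (I'' := 𝓘(ℝ, F)) y
    (hf.mdifferentiable two_ne_zero ((extChartAt I q).symm y)) hd
    (by rw [I.range_eq_univ]; exact uniqueMDiffWithinAt_univ _)
  have h2 : (mfderivWithin 𝓘(ℝ, E) I (extChartAt I q).symm (Set.range I) y)
      (mpullbackWithin 𝓘(ℝ, E) I (extChartAt I q).symm V (Set.range I) y) =
      V ((extChartAt I q).symm y) := by
    rw [mpullbackWithin_apply]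
    exact hinv.self_apply_inverse _
  have h3 : fderiv ℝ (f ∘ (extChartAt I q).symm) y =
     mfderivWithin 𝓘(ℝ, E) 𝓘(ℝ, F) (f ∘ (extChartAt I q).symm) (Set.range I) y := by
    rw [I.range_eq_univ, mfderivWithin_univ, mfderiv_eq_fderiv]
  rw [h3, hc]
  change (mfderiv I 𝓘(ℝ, F) f ((extChartAt I q).symm y)) _ = _
  erw [h2]
  rfl

omit [CompleteSpace E] [I.Boundaryless] in
theorem mdifferentiableAt_mvfderiv_apply {f : M → F} (hf : ContMDiff I 𝓘(ℝ, F) 2 f)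
    {V : ∀ x : M, TangentSpace I x} {q : M}
    (hV : MDifferentiableAt I I.tangent (fun x => (⟨x, V x⟩ : TangentBundle I M)) q) :
    MDifferentiableAt I 𝓘(ℝ, F) (fun x => mvfderiv I f x (V x)) q := by
  have h1 := (hf.contMDiff_tangentMap (m := 1) (by norm_num)).mdifferentiable one_ne_zero
    (⟨q, V q⟩ : TangentBundle I M)
  have h2 := (contMDiff_snd_tangentBundle_modelSpace F 𝓘(ℝ, F) (n := 1)).mdifferentiable one_ne_zero
    (tangentMap I 𝓘(ℝ, F) f ⟨q, V q⟩)
  exact (h2.comp _ h1).comp q hV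

/-- The derivation attached to `[V, W]` is the commutator of those attached to `V` and `W`. -/
theorem mvfderiv_mlieBracket {f : M → F} (hf : ContMDiff I 𝓘(ℝ, F) 2 f)
    {V W : ∀ x : M, TangentSpace I x} {q : M}
    (hV : MDifferentiableAt I I.tangent (fun x => (⟨x, V x⟩ : TangentBundle I M)) q)
    (hW : MDifferentiableAt I I.tangent (fun x => (⟨x, W x⟩ : TangentBundle I M)) q) :
    mvfderiv I f q (mlieBracket I V W q) =
      mvfderiv I (fun x => mvfderiv I f x (W x)) q (V q) -
        mvfderiv I (fun x => mvfderiv I f x (V x)) q (W q) := by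
  -- In the chart at `q` an iterated derivative along fields becomes one along their pullbacks to
  -- `E`, where `fderiv_apply_lieBracket` gives the commutator formula.
  have key : ∀ {V : ∀ x : M, TangentSpace I x},
      MDifferentiableAt I I.tangent (fun x => (⟨x, V x⟩ : TangentBundle I M)) q →
      ∀ w : TangentSpace I q, mvfderiv I (fun x => mvfderiv I f x (V x)) q w =
      fderiv ℝ (fun y => fderiv ℝ (f ∘ (extChartAt I q).symm) y
        (mpullbackWithin 𝓘(ℝ, E) I (extChartAt I q).symm V (Set.range I) y))
        (extChartAt I q q) w := by
    intro V hV w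
    rw [mvfderiv_eq_fderiv_extChartAt (mdifferentiableAt_mvfderiv_apply hf hV)]
    congr 1
    refine Filter.EventuallyEq.fderiv_eq ?_
    filter_upwards [extChartAt_target_mem_nhds (I := I) q] with y hy
    exact (fderiv_comp_extChartAt_symm_mpullbackWithin hf V hy).symm
  have inverse_id_apply : ∀ v : E, (ContinuousLinearMap.id ℝ E).inverse v = v := fun v => by
    rw [ContinuousLinearMap.inverse_id, ContinuousLinearMap.id_apply]
  have val : ∀ V : ∀ x : M, TangentSpace I x, V q =
      mpullbackWithin 𝓘(ℝ, E) I (extChartAt I q).symm V (Set.range I) (extChartAt I q q) := by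
    intro V
    rw [mpullbackWithin_apply, mfderivWithin_range_extChartAt_symm]
    exact (congrArg (fun x => (V x : E)) (extChartAt_to_inv (I := I) q).symm).trans
      (inverse_id_apply _).symm
  have dif : ∀ {V : ∀ x : M, TangentSpace I x},
      MDifferentiableAt I I.tangent (fun x => (⟨x, V x⟩ : TangentBundle I M)) q →
      DifferentiableAt ℝ (mpullbackWithin 𝓘(ℝ, E) I (extChartAt I q).symm V (Set.range I))
        (extChartAt I q q) := by
    intro V hV
    refine DifferentiableWithinAt.differentiableAt (mdifferentiableWithinAt_univ.2
      hV).differentiableWithinAt_mpullbackWithin_vectorField ?_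
    rw [I.range_eq_univ, Set.preimage_univ, Set.inter_univ]
    exact Filter.univ_mem
  have hg : ContDiffAt ℝ 2 (f ∘ (extChartAt I q).symm) (extChartAt I q q) := by
    have := hf.contMDiffAt.comp_contMDiffWithinAt (extChartAt I q q)
      (contMDiffWithinAt_extChartAt_symm_range (I := I) (n := 2) q (mem_extChartAt_target q))
    rw [I.range_eq_univ] at this
    exact contMDiffAt_iff_contDiffAt.1 (contMDiffWithinAt_univ.1 this)
  rw [key hW, key hV, mvfderiv_eq_fderiv_extChartAt (hf.mdifferentiable two_ne_zero q)]
  have := fderiv_apply_lieBracket hg (by simp) (dif hW) (dif hV)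
  rw [← val, ← val] at this
  rw [← this]
  congr 1
  rw [← mlieBracketWithin_univ, mlieBracketWithin_apply, mfderiv_extChartAt_self]
  refine (inverse_id_apply _).trans ?_
  rw [Set.preimage_univ, Set.univ_inter]
  refine Eq.trans ?_ (congrFun lieBracketWithin_univ _)
  congr 1
  exact I.range_eq_univ

end LieBracketDerivation

/-! ### Tangent fields of the sphere from ambient ones -/

section SphereField

variable {E : Type*} [NormedAddCommGroup E] [InnerProductSpace ℝ E] {n : ℕ}
  [Fact (Module.finrank ℝ E = n + 1)]

/-- A smooth tangent field of the unit sphere given by its values in the ambient space. -/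
theorem exists_contMDiff_field_sphere {Y : Metric.sphere (0 : E) 1 → E}
    (hY : ContMDiff (𝓡 n) 𝓘(ℝ, E) ∞ Y) (ht : ∀ z : Metric.sphere (0 : E) 1, inner ℝ (z : E) (Y z) = 0) :
    ∃ X : ∀ z : Metric.sphere (0 : E) 1, TangentSpace (𝓡 n) z,
      ContMDiff (𝓡 n) (𝓡 n).tangent ∞
        (fun z => (⟨z, X z⟩ : TangentBundle (𝓡 n) (Metric.sphere (0 : E) 1))) ∧
      ∀ z, mvfderiv (𝓡 n) ((↑) : Metric.sphere (0 : E) 1 → E) z (X z) = Y z := by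
  -- If `Y z` is orthogonal to the unit vector `z`, then `‖z + t • Y z‖ ^ 2 = 1 + t ^ 2 * ‖Y z‖ ^
  -- 2`, so `G` normalizes `z + t • Y z`. The square root never vanishes, so `G` is smooth
  -- everywhere. The scalar factor has derivative zero at `t = 0`, so the velocity there is `Y z`.
  let G : ℝ × E × E → E := fun p => (√(1 + p.1 ^ 2 * ‖p.2.2‖ ^ 2))⁻¹ • (p.2.1 + p.1 • p.2.2)
  have hpos : ∀ p : ℝ × E × E, 0 < 1 + p.1 ^ 2 * ‖p.2.2‖ ^ 2 := fun p => by positivity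
  have hG : ContDiff ℝ ∞ G := by
    refine ContDiff.smul (ContDiff.inv (ContDiff.sqrt ?_ fun p => (hpos p).ne') fun p => ?_) ?_
    · have : ContDiff ℝ ∞ fun p : ℝ × E × E => ‖p.2.2‖ ^ 2 :=
        (contDiff_snd.comp contDiff_snd).norm_sq ℝ
      exact contDiff_const.add ((contDiff_fst.pow 2).mul this)
    · exact (Real.sqrt_pos.2 (hpos p)).ne'
    · fun_prop
  let P : ℝ × Metric.sphere (0 : E) 1 → ℝ × E × E := fun p => (p.1, (p.2 : E), Y p.2)
  have hP : ContMDiff (𝓘(ℝ, ℝ).prod (𝓡 n)) 𝓘(ℝ, ℝ × E × E) ∞ P :=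
    contMDiff_fst.prodMk_space
      ((contMDiff_coe_sphere.comp contMDiff_snd).prodMk_space (hY.comp contMDiff_snd))
  have hGP : ContMDiff (𝓘(ℝ, ℝ).prod (𝓡 n)) 𝓘(ℝ, E) ∞ (G ∘ P) := hG.contMDiff.comp hP
  have hS : ∀ p, G (P p) ∈ Metric.sphere (0 : E) 1 := by
    intro p
    have h1 : ‖(p.2 : E) + p.1 • Y p.2‖ ^ 2 = 1 + p.1 ^ 2 * ‖Y p.2‖ ^ 2 := by
      rw [norm_add_sq_real, norm_eq_of_mem_sphere, inner_smul_right, ht, norm_smul, mul_pow,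
        Real.norm_eq_abs, sq_abs]
      ring
    have h2 : √(1 + p.1 ^ 2 * ‖Y p.2‖ ^ 2) = ‖(p.2 : E) + p.1 • Y p.2‖ := by
      rw [← h1, Real.sqrt_sq (norm_nonneg _)]
    have h3 : ‖(p.2 : E) + p.1 • Y p.2‖ ≠ 0 := by
      rw [← h2]; exact (Real.sqrt_pos.2 (hpos (P p))).ne'
    rw [mem_sphere_zero_iff_norm]
    change ‖(√(1 + p.1 ^ 2 * ‖Y p.2‖ ^ 2))⁻¹ • ((p.2 : E) + p.1 • Y p.2)‖ = 1
    rw [h2, norm_smul, norm_inv, norm_norm, inv_mul_cancel₀ h3]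
  let F : ℝ × Metric.sphere (0 : E) 1 → Metric.sphere (0 : E) 1 := Set.codRestrict _ _ hS
  have hF : ContMDiff (𝓘(ℝ, ℝ).prod (𝓡 n)) (𝓡 n) ∞ F := hGP.codRestrict_sphere hS
  have hF0 : ∀ z, F (0, z) = z := fun z => Subtype.ext (by simp [F, G, P])
  let e : ∀ z : Metric.sphere (0 : E) 1, TangentSpace (𝓘(ℝ, ℝ).prod (𝓡 n)) ((0 : ℝ), z) :=
    fun z => ((1 : ℝ), (0 : EuclideanSpace ℝ (Fin n)))
  -- The field is the velocity at time zero of these curves. It is smooth because it is the tangent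
  -- map of `F` applied to the section `(1, 0)` along `t = 0`.
  refine ⟨fun z => mfderiv (𝓘(ℝ, ℝ).prod (𝓡 n)) (𝓡 n) F ((0 : ℝ), z) (e z), ?_, fun z => ?_⟩
  · have s0 : ContMDiff (𝓡 n) (𝓡 n).tangent ∞ fun z : Metric.sphere (0 : E) 1 =>
        (⟨z, 0⟩ : TangentBundle (𝓡 n) (Metric.sphere (0 : E) 1)) := Bundle.contMDiff_zeroSection _ _
    have s1 : ContMDiff (𝓡 n) 𝓘(ℝ, ℝ).tangent ∞ fun _ : Metric.sphere (0 : E) 1 =>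
        (⟨0, (1 : ℝ)⟩ : TangentBundle 𝓘(ℝ, ℝ) ℝ) := contMDiff_const
    have s := ((hF.contMDiff_tangentMap (m := ∞) (by simp)).comp
      contMDiff_equivTangentBundleProd_symm).comp (s1.prodMk s0)
    convert s using 2 with z
    have : ∀ (p : Metric.sphere (0 : E) 1) (v : EuclideanSpace ℝ (Fin n)), p = z →
        (⟨z, v⟩ : TangentBundle (𝓡 n) (Metric.sphere (0 : E) 1)) = ⟨p, v⟩ := by
      rintro p v rfl; rfl
    exact this _ _ (hF0 z)
  · let c : ℝ → ℝ × Metric.sphere (0 : E) 1 := fun t => (t, z)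
    have hc : HasMFDerivAt 𝓘(ℝ, ℝ) (𝓘(ℝ, ℝ).prod (𝓡 n)) c 0
        ((ContinuousLinearMap.id ℝ ℝ).prod 0) :=
      (hasMFDerivAt_id (I := 𝓘(ℝ, ℝ)) (0 : ℝ)).prodMk (hasMFDerivAt_const z (0 : ℝ))
    have hFd := (hF.mdifferentiable (by simp) (c 0)).hasMFDerivAt
    have hid := ((contMDiff_coe_sphere (E := E) (n := n) (m := ∞)).mdifferentiable (by simp)
      (F (c 0))).hasMFDerivAt
    have h1 := (hid.comp (c 0) hFd).comp (0 : ℝ) hc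
    have h2 : HasDerivAt (fun t : ℝ => (√(1 + t ^ 2 * ‖Y z‖ ^ 2))⁻¹ • ((z : E) + t • Y z)) (Y z) 0 := by
      have a1 : HasDerivAt (fun t : ℝ => 1 + t ^ 2 * ‖Y z‖ ^ 2) 0 0 := by
        simpa using ((hasDerivAt_pow 2 (0 : ℝ)).mul_const (‖Y z‖ ^ 2)).const_add 1
      have a2 := (a1.sqrt (by simp)).inv (by simp)
      have a3 : HasDerivAt (fun t : ℝ => (z : E) + t • Y z) (Y z) 0 := by
        simpa using ((hasDerivAt_id (0 : ℝ)).smul_const (Y z)).const_add (z : E)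
      exact (a2.smul a3).congr_deriv (by simp)
    have h3 := h2.hasFDerivAt.hasMFDerivAt
    have h4 := hasMFDerivAt_unique h1 h3
    have h5 := DFunLike.congr_fun h4 (1 : ℝ)
    have h6 : ((mfderiv (𝓡 n) 𝓘(ℝ, E) ((↑) : Metric.sphere (0 : E) 1 → E) (F (c 0)))
      (mfderiv (𝓘(ℝ, ℝ).prod (𝓡 n)) (𝓡 n) F ((0 : ℝ), z) (e z)) : E) = Y z := by
      refine Eq.trans h5 ?_
      exact (one_smul ℝ (Y z))
    have : ∀ (p : Metric.sphere (0 : E) 1) (v : EuclideanSpace ℝ (Fin n)), p = z →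
        @Eq E (mfderiv (𝓡 n) 𝓘(ℝ, E) ((↑) : Metric.sphere (0 : E) 1 → E) p v) (Y z) →
        @Eq E (mfderiv (𝓡 n) 𝓘(ℝ, E) ((↑) : Metric.sphere (0 : E) 1 → E) z v) (Y z) := by
      rintro p v rfl h; exact h
    exact this _ _ (hF0 z) h6

end SphereField

/-! ### Pullback of horizontal fields and brackets under a local isometry -/

namespace SubriemannianStructure

variable {E : Type*} [NormedAddCommGroup E] [NormedSpace ℝ E] [CompleteSpace E]
  {H : Type*} [TopologicalSpace H] {I : ModelWithCorners ℝ E H}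
  {M : Type*} [TopologicalSpace M] [ChartedSpace H M] [IsManifold I ∞ M]
  {E' : Type*} [NormedAddCommGroup E'] [NormedSpace ℝ E'] [CompleteSpace E']
  {H' : Type*} [TopologicalSpace H'] {I' : ModelWithCorners ℝ E' H'}
  {M' : Type*} [TopologicalSpace M'] [ChartedSpace H' M'] [IsManifold I' ∞ M']
  {S : SubriemannianStructure I M} {S' : SubriemannianStructure I' M'}

omit [CompleteSpace E] [IsManifold I ∞ M] [CompleteSpace E'] [IsManifold I' ∞ M'] in
theorem isInvertible_mfderiv_partialDiffeomorph (φ : PartialDiffeomorph I I' M M' ∞) {q : M}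
    (hq : q ∈ φ.source) : (mfderiv I I' φ q).IsInvertible := by
  have h : IsLocalDiffeomorphAt I I' ∞ φ q := ⟨φ, hq, fun _ _ => rfl⟩
  exact ⟨h.mfderivToContinuousLinearEquiv (by simp), rfl⟩

omit [CompleteSpace E] in
theorem IsHorizontalFieldNear.mdifferentiableAt {q : M} {X : ∀ x : M, TangentSpace I x}
    (h : S.IsHorizontalFieldNear q X) :
    MDifferentiableAt I I.tangent (fun x => (⟨x, X x⟩ : TangentBundle I M)) q := by
  obtain ⟨U, hU, hq, hX, -⟩ := h
  exact (hX.contMDiffAt (hU.mem_nhds hq)).mdifferentiableAt (by simp)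

omit [CompleteSpace E'] in
theorem isHorizontalFieldNear_mpullback (φ : PartialDiffeomorph I I' M M' ∞)
    (hφ : ∀ q ∈ φ.source, S.IsIsometryAt S' φ q) {q : M} (hq : q ∈ φ.source)
    {X : ∀ x : M', TangentSpace I' x} (hX : S'.IsHorizontalFieldNear (φ q) X) :
    S.IsHorizontalFieldNear q (mpullback I I' φ X) := by
  obtain ⟨U, hU, hqU, hXU, hXH⟩ := hX
  refine ⟨φ.source ∩ φ ⁻¹' U, φ.contMDiffOn.continuousOn.isOpen_inter_preimage φ.open_source hU,
    ⟨hq, hqU⟩, fun x hx => ?_, fun x hx => ?_⟩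
  · have h1 : ContMDiffAt I' I'.tangent ∞ (fun x => (⟨x, X x⟩ : TangentBundle I' M')) (φ x) :=
      hXU.contMDiffAt (hU.mem_nhds hx.2)
    exact (h1.mpullback_vectorField_preimage
      (φ.contMDiffOn.contMDiffAt (φ.open_source.mem_nhds hx.1))
      (isInvertible_mfderiv_partialDiffeomorph φ hx.1) (by simp)).contMDiffWithinAt
  · have h1 := hXH _ hx.2
    rw [← (hφ x hx.1).map_horizontal] at h1
    obtain ⟨v, hv, hv'⟩ := h1
    have h2 : mpullback I I' φ X x = v := by
      rw [mpullback_apply, ← hv']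
      exact (isInvertible_mfderiv_partialDiffeomorph φ hx.1).inverse_apply_self v
    rw [h2]
    exact hv

omit [CompleteSpace E] [IsManifold I ∞ M] [CompleteSpace E'] [IsManifold I' ∞ M'] in
theorem mfderiv_mpullback (φ : PartialDiffeomorph I I' M M' ∞) {q : M} (hq : q ∈ φ.source)
    (X : ∀ x : M', TangentSpace I' x) :
    mfderiv I I' φ q (mpullback I I' φ X q) = X (φ q) := by
  rw [mpullback_apply]
  exact (isInvertible_mfderiv_partialDiffeomorph φ hq).self_apply_inverse _

omit [CompleteSpace E'] in
theorem mfderiv_mlieBracket_mpullback (φ : PartialDiffeomorph I I' M M' ∞) {q : M}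
    (hq : q ∈ φ.source) {X Y : ∀ x : M', TangentSpace I' x}
    (hX : S'.IsHorizontalFieldNear (φ q) X) (hY : S'.IsHorizontalFieldNear (φ q) Y) :
    mfderiv I I' φ q (mlieBracket I (mpullback I I' φ X) (mpullback I I' φ Y) q) =
      mlieBracket I' X Y (φ q) := by
  have e : minSmoothness ℝ 2 = 2 := minSmoothness_of_isRCLikeNormedField
  have : IsManifold I (minSmoothness ℝ 2) M := by rw [e]; infer_instance
  have : IsManifold I' (minSmoothness ℝ 2) M' := by rw [e]; infer_instance
  rw [← mpullback_mlieBracket (n := ∞) hX.mdifferentiableAt hY.mdifferentiableAt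
    (φ.contMDiffOn.contMDiffAt (φ.open_source.mem_nhds hq)) (by rw [e]; exact ENat.LEInfty.out)]
  exact mfderiv_mpullback φ hq _

end SubriemannianStructure

/-! ### Tangent vectors and covectors of the sphere inside `ℍ²` -/

namespace S7

theorem inner_dIncl_eq_zero (q : S7) (u : TangentSpace (𝓡 7) q) :
    inner ℝ (q : QuaternionPlane) (dIncl q u) = 0 := by
  have h : dIncl q u ∈ (ℝ ∙ (q : QuaternionPlane))ᗮ := by
    rw [← range_mvfderiv_subtypeVal (n := 7) q]
    exact ⟨u, rfl⟩
  exact Submodule.mem_orthogonal_singleton_iff_inner_right.1 h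

theorem exists_dIncl_eq {q : S7} {a : QuaternionPlane} (ha : inner ℝ (q : QuaternionPlane) a = 0) :
    ∃ u, dIncl q u = a := by
  have h : a ∈ (ℝ ∙ (q : QuaternionPlane))ᗮ :=
    Submodule.mem_orthogonal_singleton_iff_inner_right.2 ha
  rw [← range_mvfderiv_subtypeVal (n := 7) q] at h
  exact h

theorem inner_self_eq_one (q : S7) : inner ℝ (q : QuaternionPlane) (q : QuaternionPlane) = 1 := by
  rw [real_inner_self_eq_norm_sq, norm_eq_of_mem_sphere, one_pow]

theorem exists_leftInverse_dIncl (q : S7) :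
    ∃ g : QuaternionPlane →ₗ[ℝ] TangentSpace (𝓡 7) q, ∀ u, g (dIncl q u) = u := by
  obtain ⟨g, hg⟩ := LinearMap.exists_leftInverse_of_injective (dIncl q)
    (LinearMap.ker_eq_bot.2 (dIncl_injective q))
  exact ⟨g, fun u => DFunLike.congr_fun hg u⟩

theorem exists_inner_dIncl (q : S7) (l : TangentSpace (𝓡 7) q →ₗ[ℝ] ℝ) :
    ∃ ζ : QuaternionPlane, inner ℝ (q : QuaternionPlane) ζ = 0 ∧
      ∀ u, l u = inner ℝ ζ (dIncl q u) := by
  obtain ⟨g, hg⟩ := exists_leftInverse_dIncl q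
  let f : StrongDual ℝ QuaternionPlane := LinearMap.toContinuousLinearMap (l ∘ₗ g)
  let ζ := (InnerProductSpace.toDual ℝ QuaternionPlane).symm f
  -- Removing the radial component does not change the pairing with tangent vectors and makes the
  -- representing vector tangent.
  refine ⟨ζ - inner ℝ (q : QuaternionPlane) ζ • (q : QuaternionPlane), ?_, fun u => ?_⟩
  · rw [inner_sub_right, inner_smul_right, inner_self_eq_one]
    ring
  · rw [inner_sub_left, inner_smul_left, inner_dIncl_eq_zero, mul_zero, sub_zero,
      InnerProductSpace.toDual_symm_apply]
    change l u = l (g (dIncl q u))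
    rw [hg]

theorem dIncl_mlieBracket {q : S7} {X Y : ∀ z : S7, TangentSpace (𝓡 7) z}
    (hX : MDifferentiableAt (𝓡 7) (𝓡 7).tangent (fun z => (⟨z, X z⟩ : TangentBundle (𝓡 7) S7)) q)
    (hY : MDifferentiableAt (𝓡 7) (𝓡 7).tangent (fun z => (⟨z, Y z⟩ : TangentBundle (𝓡 7) S7)) q) :
    dIncl q (mlieBracket (𝓡 7) X Y q) =
      mvfderiv (𝓡 7) (fun z => dIncl z (Y z)) q (X q) -
        mvfderiv (𝓡 7) (fun z => dIncl z (X z)) q (Y q) :=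
  mvfderiv_mlieBracket contMDiff_coe_sphere hX hY

theorem mdifferentiableAt_dIncl {q : S7} {X : ∀ z : S7, TangentSpace (𝓡 7) z}
    (hX : MDifferentiableAt (𝓡 7) (𝓡 7).tangent (fun z => (⟨z, X z⟩ : TangentBundle (𝓡 7) S7)) q) :
    MDifferentiableAt (𝓡 7) 𝓘(ℝ, QuaternionPlane) (fun z => dIncl z (X z)) q :=
  mdifferentiableAt_mvfderiv_apply contMDiff_coe_sphere hX

variable {V : S7 → Submodule ℝ QuaternionPlane}

/-- The vectors of `V q` which are tangent to the sphere at `q`. -/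
def tangentPart (V : S7 → Submodule ℝ QuaternionPlane) (q : S7) : Submodule ℝ QuaternionPlane :=
  V q ⊓ (ℝ ∙ (q : QuaternionPlane))ᗮ

theorem mem_tangentPart {q : S7} {a : QuaternionPlane} :
    a ∈ tangentPart V q ↔ a ∈ V q ∧ inner ℝ (q : QuaternionPlane) a = 0 := by
  rw [tangentPart, Submodule.mem_inf, Submodule.mem_orthogonal_singleton_iff_inner_right]

theorem dIncl_mem_tangentPart {q : S7} {u : TangentSpace (𝓡 7) q} :
    dIncl q u ∈ tangentPart V q ↔ u ∈ (inducedStructure V).horizontal q := by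
  rw [mem_tangentPart, and_iff_left (inner_dIncl_eq_zero q u)]
  rfl

theorem exists_horizontal_of_mem_tangentPart {q : S7} {a : QuaternionPlane}
    (ha : a ∈ tangentPart V q) :
    ∃ u : (inducedStructure V).horizontal q, dIncl q u = a := by
  obtain ⟨u, rfl⟩ := exists_dIncl_eq (mem_tangentPart.1 ha).2
  exact ⟨⟨u, dIncl_mem_tangentPart.1 ha⟩, rfl⟩

/-- The bilinear map `Ω` computes Lie brackets at `q` of fields tangent to `V`, modulo `V`. -/
structure IsCurvatureAt (V : S7 → Submodule ℝ QuaternionPlane) (q : S7)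
    (Ω : QuaternionPlane →ₗ[ℝ] QuaternionPlane →ₗ[ℝ] QuaternionPlane) : Prop where
  bracket : ∀ X Y : ∀ z : S7, TangentSpace (𝓡 7) z,
    (inducedStructure V).IsHorizontalFieldNear q X →
    (inducedStructure V).IsHorizontalFieldNear q Y →
    dIncl q (mlieBracket (𝓡 7) X Y q) - Ω (dIncl q (X q)) (dIncl q (Y q)) ∈ tangentPart V q
  extend : ∀ u ∈ (inducedStructure V).horizontal q, ∃ X : ∀ z : S7, TangentSpace (𝓡 7) z,
    (inducedStructure V).IsHorizontalFieldNear q X ∧ X q = u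

/-! ### Nonsingularity and isometries expressed through the bracket form -/

namespace IsCurvatureAt

variable {q : S7} {Ω : QuaternionPlane →ₗ[ℝ] QuaternionPlane →ₗ[ℝ] QuaternionPlane}

theorem mlieBracket_mem {X Y : ∀ z : S7, TangentSpace (𝓡 7) z}
    (hX : (inducedStructure V).IsHorizontalFieldNear q X)
    (hY : (inducedStructure V).IsHorizontalFieldNear q Y) :
    mlieBracket (𝓡 7) X Y q ∈ (inducedStructure V).horizontalSq q :=
  Submodule.mem_sup_right (Submodule.subset_span ⟨X, Y, hX, hY, rfl⟩)

/-- Any two horizontal vectors extend to horizontal fields, whose bracket differs from the value of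
`Ω` by a horizontal vector. So `Ω` takes values in `𝓗²` on the horizontal space, and its class
modulo `𝓗` is the required bilinear map. -/
theorem exists_isTangentBracket (h : IsCurvatureAt V q Ω) :
    ∃ β, (inducedStructure V).IsTangentBracket q β := by
  obtain ⟨g, hg⟩ := exists_leftInverse_dIncl q
  have key : ∀ X Y : ∀ z : S7, TangentSpace (𝓡 7) z,
      (inducedStructure V).IsHorizontalFieldNear q X →
      (inducedStructure V).IsHorizontalFieldNear q Y →
      mlieBracket (𝓡 7) X Y q - g (Ω (dIncl q (X q)) (dIncl q (Y q))) ∈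
        (inducedStructure V).horizontal q := by
    intro X Y hX hY
    obtain ⟨u, hu⟩ := exists_horizontal_of_mem_tangentPart (h.bracket X Y hX hY)
    have := congrArg g hu
    rw [map_sub, hg, hg] at this
    rw [← this]
    exact u.2
  have mem : ∀ u v : (inducedStructure V).horizontal q,
      g (Ω (dIncl q u) (dIncl q v)) ∈ (inducedStructure V).horizontalSq q := by
    intro u v
    obtain ⟨X, hX, hXu⟩ := h.extend u u.2
    obtain ⟨Y, hY, hYv⟩ := h.extend v v.2
    have h1 := key X Y hX hY
    rw [hXu, hYv] at h1
    have h2 := Submodule.sub_mem _ (mlieBracket_mem hX hY)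
      (Submodule.mem_sup_left h1 : _ ∈ (inducedStructure V).horizontalSq q)
    rwa [sub_sub_cancel] at h2
  refine ⟨LinearMap.mk₂ ℝ (fun u v => Submodule.Quotient.mk ⟨_, mem u v⟩) ?_ ?_ ?_ ?_, ?_⟩
  · intro u u' v
    rw [← Submodule.Quotient.mk_add]
    congr 1
    exact Subtype.ext (by simp)
  · intro c u v
    rw [← Submodule.Quotient.mk_smul]
    congr 1
    exact Subtype.ext (by simp)
  · intro u v v'
    rw [← Submodule.Quotient.mk_add]
    congr 1
    exact Subtype.ext (by simp)
  · intro c u v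
    rw [← Submodule.Quotient.mk_smul]
    congr 1
    exact Subtype.ext (by simp)
  · intro X Y hX hY u v w hu hv hw
    rw [LinearMap.mk₂_apply, eq_comm, Submodule.Quotient.eq]
    have h1 := key X Y hX hY
    rw [← hu, ← hv, ← hw] at h1
    exact h1

/-- Existence of a bracket rules out the default value `0` of `tangentBracket`. Extending `u` and
`v` to fields then determines its value, and the horizontal error term is killed by `ζ`. -/
theorem dual_tangentBracket (h : IsCurvatureAt V q Ω)
    {Z : Module.Dual ℝ ((inducedStructure V).secondLayer q)} {ζ : QuaternionPlane}
    (hZ : ∀ w : (inducedStructure V).horizontalSq q,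
      Z (Submodule.Quotient.mk w) = inner ℝ ζ (dIncl q w))
    (u v : (inducedStructure V).horizontal q) :
    Z ((inducedStructure V).tangentBracket q u v) = inner ℝ ζ (Ω (dIncl q u) (dIncl q v)) := by
  have hβ : (inducedStructure V).IsTangentBracket q ((inducedStructure V).tangentBracket q) := by
    rw [SubriemannianStructure.tangentBracket, dif_pos h.exists_isTangentBracket]
    exact h.exists_isTangentBracket.choose_spec
  obtain ⟨X, hX, hXu⟩ := h.extend u u.2
  obtain ⟨Y, hY, hYv⟩ := h.extend v v.2
  rw [hβ X Y hX hY u v ⟨_, mlieBracket_mem hX hY⟩ hXu.symm hYv.symm rfl, hZ]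
  obtain ⟨t, ht⟩ := exists_horizontal_of_mem_tangentPart (h.bracket X Y hX hY)
  have ht' := hZ ⟨t, Submodule.mem_sup_left t.2⟩
  rw [(Submodule.Quotient.mk_eq_zero _).2 (by exact t.2), map_zero] at ht'
  rw [hXu, hYv, eq_sub_iff_add_eq] at ht
  change inner ℝ ζ (dIncl q (mlieBracket (𝓡 7) X Y q)) = _
  rw [← ht, inner_add_right, ← ht', zero_add]

/-- `Z` is represented by some `ζ` orthogonal to the horizontal space, and `J_Z` is obtained by
inverting the metric. Its kernel is the radical of the form, so a trivial radical gives injectivity,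
hence bijectivity in finite dimension. -/
theorem nonsingularAt (h : IsCurvatureAt V q Ω)
    (hΩ : ∀ ζ, inner ℝ (q : QuaternionPlane) ζ = 0 → (∀ a ∈ tangentPart V q, inner ℝ ζ a = 0) →
      ζ ≠ 0 → ∀ a ∈ tangentPart V q, a ≠ 0 → ∃ b ∈ tangentPart V q, inner ℝ ζ (Ω a b) ≠ 0) :
    (inducedStructure V).NonsingularAt q := by
  intro Z hZ
  obtain ⟨l, hl⟩ := LinearMap.exists_extend (Z ∘ₗ Submodule.mkQ _)
  obtain ⟨ζ, hζ, hlζ⟩ := exists_inner_dIncl q l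
  have hZζ : ∀ w : (inducedStructure V).horizontalSq q,
      Z (Submodule.Quotient.mk w) = inner ℝ ζ (dIncl q w) := fun w => by
    rw [← hlζ]
    exact (DFunLike.congr_fun hl w).symm
  have hζ0 : ζ ≠ 0 := by
    rintro rfl
    refine hZ (LinearMap.ext fun w => ?_)
    obtain ⟨w, rfl⟩ := Submodule.Quotient.mk_surjective _ w
    rw [hZζ, inner_zero_left, LinearMap.zero_apply]
  have hζH : ∀ a ∈ tangentPart V q, inner ℝ ζ a = 0 := by
    intro a ha
    obtain ⟨t, rfl⟩ := exists_horizontal_of_mem_tangentPart ha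
    have ht' := hZζ ⟨t, Submodule.mem_sup_left t.2⟩
    rw [(Submodule.Quotient.mk_eq_zero _).2 (by exact t.2), map_zero] at ht'
    exact ht'.symm
  let S := inducedStructure V
  have : FiniteDimensional ℝ (TangentSpace (𝓡 7) q) :=
    inferInstanceAs (FiniteDimensional ℝ (EuclideanSpace ℝ (Fin 7)))
  have minj : Function.Injective (S.metric q) := by
    refine (injective_iff_map_eq_zero _).2 fun u hu => ?_
    by_contra hne
    have := S.metric_pos q u hne
    rw [hu] at this
    exact lt_irrefl _ this
  let m : S.horizontal q ≃ₗ[ℝ] Module.Dual ℝ (S.horizontal q) :=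
    LinearEquiv.ofInjectiveOfFinrankEq (S.metric q) minj Subspace.dual_finrank_eq.symm
  let J : S.horizontal q →ₗ[ℝ] S.horizontal q :=
    m.symm.toLinearMap ∘ₗ ((S.tangentBracket q).compr₂ Z)
  have hJ : ∀ u v, S.metric q (J u) v = Z (S.tangentBracket q u v) := by
    intro u v
    have : m (J u) = (S.tangentBracket q).compr₂ Z u := m.apply_symm_apply _
    exact DFunLike.congr_fun this v
  have Jinj : Function.Injective J := by
    refine (injective_iff_map_eq_zero _).2 fun u hu => ?_
    by_contra hne
    obtain ⟨b, hb, hb'⟩ := hΩ ζ hζ hζH hζ0 (dIncl q u) (dIncl_mem_tangentPart.2 u.2)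
      fun h0 => hne (Subtype.ext (dIncl_injective q (by simpa using h0)))
    obtain ⟨v, rfl⟩ := exists_horizontal_of_mem_tangentPart hb
    rw [← h.dual_tangentBracket hZζ, ← hJ, hu] at hb'
    simp at hb'
  exact ⟨J, hJ, Jinj, LinearMap.injective_iff_surjective.1 Jinj⟩

/-- For `u` in the radical, `|J u|² = Z [u, J u] = 0`, so `J` is not injective. The hypothesis `hne`
ensures that the functional induced by `ζ` on the second layer is not zero. -/
theorem not_nonsingularAt (h : IsCurvatureAt V q Ω) {ζ a : QuaternionPlane}
    (hζ : ∀ a ∈ tangentPart V q, inner ℝ ζ a = 0) (ha : a ∈ tangentPart V q) (ha0 : a ≠ 0)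
    (haΩ : ∀ b ∈ tangentPart V q, inner ℝ ζ (Ω a b) = 0)
    (hne : ∃ b ∈ tangentPart V q, ∃ c ∈ tangentPart V q, inner ℝ ζ (Ω b c) ≠ 0) :
    ¬ (inducedStructure V).NonsingularAt q := by
  intro hns
  let l : (inducedStructure V).horizontalSq q →ₗ[ℝ] ℝ :=
    innerₗ QuaternionPlane ζ ∘ₗ dIncl q ∘ₗ Submodule.subtype _
  let Z : Module.Dual ℝ ((inducedStructure V).secondLayer q) :=
    Submodule.liftQ _ l fun w hw => hζ _ (dIncl_mem_tangentPart.2 hw)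
  have hZ : ∀ w : (inducedStructure V).horizontalSq q,
      Z (Submodule.Quotient.mk w) = inner ℝ ζ (dIncl q w) := fun w => rfl
  have hZ0 : Z ≠ 0 := by
    rintro h0
    obtain ⟨b, hb, c, hc, hbc⟩ := hne
    obtain ⟨u, rfl⟩ := exists_horizontal_of_mem_tangentPart hb
    obtain ⟨v, rfl⟩ := exists_horizontal_of_mem_tangentPart hc
    rw [← h.dual_tangentBracket hZ, h0] at hbc
    exact hbc rfl
  obtain ⟨J, hJ, hJb⟩ := hns Z hZ0
  obtain ⟨u, rfl⟩ := exists_horizontal_of_mem_tangentPart ha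
  have hJu : J u = 0 := by
    by_contra hne
    have h1 := (inducedStructure V).metric_pos q _ hne
    rw [hJ, h.dual_tangentBracket hZ, haΩ _ (dIncl_mem_tangentPart.2 (J u).2)] at h1
    exact lt_irrefl _ h1
  refine ha0 ?_
  rw [hJb.1 (hJu.trans (map_zero J).symm)]
  simp

/-- A local isometry intertwines the brackets of the two structures. -/
theorem exists_linearMap_of_isIsometryAt {V' : S7 → Submodule ℝ QuaternionPlane}
    {Ω' : QuaternionPlane →ₗ[ℝ] QuaternionPlane →ₗ[ℝ] QuaternionPlane}
    (φ : PartialDiffeomorph (𝓡 7) (𝓡 7) S7 S7 ∞)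
    (hφ : ∀ q ∈ φ.source, (inducedStructure V).IsIsometryAt (inducedStructure V') φ q)
    (hq : q ∈ φ.source) (h : IsCurvatureAt V q Ω) (h' : IsCurvatureAt V' (φ q) Ω') :
    ∃ L : QuaternionPlane →ₗ[ℝ] QuaternionPlane,
      (∀ a ∈ tangentPart V q, L a ∈ tangentPart V' (φ q)) ∧
      (∀ b ∈ tangentPart V' (φ q), ∃ a ∈ tangentPart V q, L a = b) ∧
      (∀ a ∈ tangentPart V q, ∀ b ∈ tangentPart V q, inner ℝ (L a) (L b) = inner ℝ a b) ∧
      ∀ ζ, (∀ b ∈ tangentPart V' (φ q), inner ℝ ζ b = 0) →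
        ∃ ξ, inner ℝ (q : QuaternionPlane) ξ = 0 ∧ (∀ a ∈ tangentPart V q, inner ℝ ξ a = 0) ∧
          (ζ ≠ 0 → inner ℝ (φ q : QuaternionPlane) ζ = 0 → ξ ≠ 0) ∧
          ∀ a ∈ tangentPart V q, ∀ b ∈ tangentPart V q,
            inner ℝ ζ (Ω' (L a) (L b)) = inner ℝ ξ (Ω a b) := by
  obtain ⟨g, hg⟩ := exists_leftInverse_dIncl q
  have iso := hφ q hq
  let D : TangentSpace (𝓡 7) q →ₗ[ℝ] TangentSpace (𝓡 7) (φ q) :=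
    (mfderiv (𝓡 7) (𝓡 7) φ q).toLinearMap
  let L : QuaternionPlane →ₗ[ℝ] QuaternionPlane := dIncl (φ q) ∘ₗ D ∘ₗ g
  have hL : ∀ u, L (dIncl q u) = dIncl (φ q) (D u) := fun u => by
    change dIncl (φ q) (D (g (dIncl q u))) = _
    rw [hg]
  have hD : ∀ u ∈ (inducedStructure V).horizontal q,
      D u ∈ (inducedStructure V').horizontal (φ q) := fun u hu => by
    rw [← iso.map_horizontal]
    exact Submodule.mem_map_of_mem hu
  have hsurj : ∀ b ∈ tangentPart V' (φ q), ∃ u ∈ (inducedStructure V).horizontal q,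
      dIncl (φ q) (D u) = b := by
    intro b hb
    obtain ⟨v, rfl⟩ := exists_horizontal_of_mem_tangentPart hb
    obtain ⟨u, hu, huv⟩ := iso.map_horizontal.ge v.2
    exact ⟨u, hu, congrArg _ huv⟩
  refine ⟨L, fun a ha => ?_, fun b hb => ?_, fun a ha b hb => ?_, fun ζ hζ => ?_⟩
  · obtain ⟨u, rfl⟩ := exists_horizontal_of_mem_tangentPart ha
    rw [hL]
    exact dIncl_mem_tangentPart.2 (hD u u.2)
  · obtain ⟨u, hu, rfl⟩ := hsurj b hb
    exact ⟨dIncl q u, dIncl_mem_tangentPart.2 hu, hL u⟩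
  · obtain ⟨u, rfl⟩ := exists_horizontal_of_mem_tangentPart ha
    obtain ⟨v, rfl⟩ := exists_horizontal_of_mem_tangentPart hb
    rw [hL, hL]
    exact iso.map_metric u v ⟨_, hD u u.2⟩ ⟨_, hD v v.2⟩ rfl rfl
  · obtain ⟨ξ, hξq, hξ⟩ := exists_inner_dIncl q (innerₗ QuaternionPlane ζ ∘ₗ dIncl (φ q) ∘ₗ D)
    have hξ' : ∀ u, inner ℝ ζ (dIncl (φ q) (D u)) = inner ℝ ξ (dIncl q u) := hξ
    have hξH : ∀ a ∈ tangentPart V q, inner ℝ ξ a = 0 := by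
      intro a ha
      obtain ⟨u, rfl⟩ := exists_horizontal_of_mem_tangentPart ha
      rw [← hξ']
      exact hζ _ (dIncl_mem_tangentPart.2 (hD u u.2))
    refine ⟨ξ, hξq, hξH, ?_, fun a ha b hb => ?_⟩
    -- A tangent `ζ` is in the image of the differential, so a vanishing pulled-back covector would
    -- give `⟨ζ, ζ⟩ = 0`.
    · rintro hζ0 hζp rfl
      obtain ⟨v, hv⟩ := exists_dIncl_eq hζp
      obtain ⟨e, he⟩ := SubriemannianStructure.isInvertible_mfderiv_partialDiffeomorph φ hq
      have h1 := hξ' (e.symm v)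
      have h2 : D (e.symm v) = v := by
        change (mfderiv (𝓡 7) (𝓡 7) φ q) (e.symm v) = v
        rw [← he]
        exact e.apply_symm_apply v
      rw [h2, hv, inner_zero_left] at h1
      exact hζ0 (inner_self_eq_zero.1 h1)
    · obtain ⟨u, rfl⟩ := exists_horizontal_of_mem_tangentPart ha
      obtain ⟨v, rfl⟩ := exists_horizontal_of_mem_tangentPart hb
      -- Extension is done on the target and the fields are pulled back, so that naturality of the
      -- bracket compares the two forms.
      obtain ⟨X, hX, hXu⟩ := h'.extend _ (hD u u.2)
      obtain ⟨Y, hY, hYv⟩ := h'.extend _ (hD v v.2)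
      have hX' := SubriemannianStructure.isHorizontalFieldNear_mpullback φ hφ hq hX
      have hY' := SubriemannianStructure.isHorizontalFieldNear_mpullback φ hφ hq hY
      obtain ⟨e, he⟩ := SubriemannianStructure.isInvertible_mfderiv_partialDiffeomorph φ hq
      have Dinj : Function.Injective D := by
        have : Function.Injective (e : TangentSpace (𝓡 7) q →L[ℝ] TangentSpace (𝓡 7) (φ q)) :=
          e.injective
        rw [he] at this
        exact this
      have eX : mpullback (𝓡 7) (𝓡 7) φ X q = u :=
        Dinj ((SubriemannianStructure.mfderiv_mpullback φ hq X).trans hXu)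
      have eY : mpullback (𝓡 7) (𝓡 7) φ Y q = v :=
        Dinj ((SubriemannianStructure.mfderiv_mpullback φ hq Y).trans hYv)
      have h1 := hζ _ (h'.bracket X Y hX hY)
      have h2 := hξH _ (h.bracket _ _ hX' hY')
      rw [hXu, hYv, inner_sub_right, sub_eq_zero] at h1
      rw [eX, eY, inner_sub_right, sub_eq_zero, ← hξ'] at h2
      rw [hL, hL, ← h1, ← h2]
      congr 2
      exact (SubriemannianStructure.mfderiv_mlieBracket_mpullback φ hq hX hY).symm

end IsCurvatureAt

end S7

/-! ### Curvature of distributions defined by skew frames -/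

namespace S7

theorem mvfderiv_congr {F : Type*} [NormedAddCommGroup F] [NormedSpace ℝ F] {f g : S7 → F} {q : S7}
    (h : f =ᶠ[nhds q] g) (w : TangentSpace (𝓡 7) q) :
    mvfderiv (𝓡 7) f q w = mvfderiv (𝓡 7) g q w := by
  change mfderiv (𝓡 7) 𝓘(ℝ, F) f q w = mfderiv (𝓡 7) 𝓘(ℝ, F) g q w
  rw [h.mfderiv_eq]
  rfl

theorem mvfderiv_comp_prodMk_coe {F : Type*} [NormedAddCommGroup F] [NormedSpace ℝ F]
    {X : S7 → QuaternionPlane} {q : S7}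
    (hX : MDifferentiableAt (𝓡 7) 𝓘(ℝ, QuaternionPlane) X q)
    {G : QuaternionPlane × QuaternionPlane → F} {G' : QuaternionPlane × QuaternionPlane →L[ℝ] F}
    (hG : HasFDerivAt G G' (X q, (q : QuaternionPlane))) (w : TangentSpace (𝓡 7) q) :
    mvfderiv (𝓡 7) (fun z : S7 => G (X z, (z : QuaternionPlane))) q w =
      G' (mvfderiv (𝓡 7) X q w, dIncl q w) := by
  have h1 := hX.hasMFDerivAt
  have h2 := ((contMDiff_coe_sphere (E := QuaternionPlane) (n := 7) (m := 1)).mdifferentiable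
    one_ne_zero q).hasMFDerivAt
  have h3 := HasMFDerivAt.comp (I' := 𝓘(ℝ, QuaternionPlane × QuaternionPlane)) q
    (f := fun z : S7 => (X z, (z : QuaternionPlane))) hG.hasMFDerivAt ⟨h1.1.prodMk h2.1, h1.2.prodMk h2.2⟩
  exact DFunLike.congr_fun h3.mfderiv w

variable {ι : Type*} [Fintype ι]

/-- A family of skew maps which are orthonormal at each point of the sphere. -/
structure IsSkewFrame [DecidableEq ι] (A : ι → QuaternionPlane →L[ℝ] QuaternionPlane) : Prop where
  skew : ∀ l u v, inner ℝ (A l u) v = - inner ℝ u (A l v)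
  orthonormal : ∀ (q : S7) l m, inner ℝ (A l (q : QuaternionPlane)) (A m (q : QuaternionPlane)) =
    if l = m then 1 else 0

/-- The span at `q` of the fields of a frame. -/
def frameSpan (A : ι → QuaternionPlane →L[ℝ] QuaternionPlane) (q : S7) :
    Submodule ℝ QuaternionPlane :=
  Submodule.span ℝ (Set.range fun l => A l (q : QuaternionPlane))

/-- The orthogonal projection on `frameSpan A q`, as a function of the vector and of `q`. -/
def frameProj (A : ι → QuaternionPlane →L[ℝ] QuaternionPlane) (p : QuaternionPlane × QuaternionPlane) :
    QuaternionPlane :=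
  ∑ l, inner ℝ p.1 (A l p.2) • A l p.2

/-- The brackets of fields orthogonal to a frame, modulo such fields. -/
def frameOrthogonalCurvature (A : ι → QuaternionPlane →L[ℝ] QuaternionPlane) (q : S7) :
    QuaternionPlane →ₗ[ℝ] QuaternionPlane →ₗ[ℝ] QuaternionPlane :=
  LinearMap.mk₂ ℝ (fun u v => ∑ l, (2 * inner ℝ u (A l v)) • A l (q : QuaternionPlane))
    (fun u u' v => by simp only [inner_add_left, mul_add, add_smul, Finset.sum_add_distrib])
    (fun c u v => by
      simp only [inner_smul_left, Finset.smul_sum, smul_smul]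
      exact Finset.sum_congr rfl fun l _ => by simp; ring_nf)
    (fun u v v' => by
      simp only [map_add, inner_add_right, mul_add, add_smul, Finset.sum_add_distrib])
    (fun c u v => by
      simp only [map_smul, inner_smul_right, Finset.smul_sum, smul_smul]
      exact Finset.sum_congr rfl fun l _ => by ring_nf)

/-- The brackets of combinations of the fields of a frame, modulo such combinations. -/
def frameCurvature (A : ι → QuaternionPlane →L[ℝ] QuaternionPlane) (q : S7) :
    QuaternionPlane →ₗ[ℝ] QuaternionPlane →ₗ[ℝ] QuaternionPlane :=
  LinearMap.mk₂ ℝ (fun u v => ∑ l, (inner ℝ v (A l (q : QuaternionPlane)) • A l u -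
      inner ℝ u (A l (q : QuaternionPlane)) • A l v))
    (fun u u' v => by
      rw [← Finset.sum_add_distrib]
      exact Finset.sum_congr rfl fun l _ => by
        simp only [map_add, inner_add_left, smul_add, add_smul]; abel)
    (fun c u v => by
      rw [Finset.smul_sum]
      exact Finset.sum_congr rfl fun l _ => by
        simp only [map_smul, inner_smul_left, smul_sub, smul_smul, RCLike.conj_to_real]; ring_nf)
    (fun u v v' => by
      rw [← Finset.sum_add_distrib]
      exact Finset.sum_congr rfl fun l _ => by
        simp only [map_add, inner_add_left, smul_add, add_smul]; abel)
    (fun c u v => by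
      rw [Finset.smul_sum]
      exact Finset.sum_congr rfl fun l _ => by
        simp only [map_smul, inner_smul_left, smul_sub, smul_smul, RCLike.conj_to_real]; ring_nf)

theorem mem_frameSpan_orthogonal {A : ι → QuaternionPlane →L[ℝ] QuaternionPlane} {q : S7}
    {a : QuaternionPlane} :
    a ∈ (frameSpan A q)ᗮ ↔ ∀ l, inner ℝ a (A l (q : QuaternionPlane)) = 0 := by
  rw [Submodule.mem_orthogonal']
  constructor
  · exact fun h l => h _ (Submodule.subset_span ⟨l, rfl⟩)
  · intro h b hb
    obtain ⟨c, rfl⟩ := (Submodule.mem_span_range_iff_exists_fun ℝ).1 hb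
    rw [inner_sum]
    exact Finset.sum_eq_zero fun l _ => by rw [inner_smul_right, h, mul_zero]

namespace IsSkewFrame

variable [DecidableEq ι] {A : ι → QuaternionPlane →L[ℝ] QuaternionPlane} (hA : IsSkewFrame A)

include hA

omit [Fintype ι] in
theorem inner_self_apply (l : ι) (u : QuaternionPlane) : inner ℝ u (A l u) = 0 := by
  have := hA.skew l u u
  rw [real_inner_comm] at this
  linarith

theorem inner_frameProj (q : S7) (a : QuaternionPlane) (l : ι) :
    inner ℝ (frameProj A (a, q)) (A l (q : QuaternionPlane)) = inner ℝ a (A l (q : QuaternionPlane)) := by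
  simp [frameProj, sum_inner, inner_smul_left, hA.orthonormal]

theorem frameProj_eq_self {q : S7} {a : QuaternionPlane} (ha : a ∈ frameSpan A q) :
    frameProj A (a, q) = a := by
  obtain ⟨c, rfl⟩ := (Submodule.mem_span_range_iff_exists_fun ℝ).1 ha
  simp [frameProj, sum_inner, inner_smul_left, hA.orthonormal]

omit [Fintype ι] in
theorem frameSpan_le (q : S7) : frameSpan A q ≤ (ℝ ∙ (q : QuaternionPlane))ᗮ := by
  refine Submodule.span_le.2 ?_
  rintro _ ⟨l, rfl⟩
  exact Submodule.mem_orthogonal_singleton_iff_inner_right.2 (hA.inner_self_apply l _)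

omit [Fintype ι] in
theorem tangentPart_frameSpan (q : S7) : tangentPart (frameSpan A) q = frameSpan A q :=
  inf_eq_left.2 (hA.frameSpan_le q)

/-- Differentiating `⟨X, A_l z⟩ = 0` along `w` gives `⟨dX w, A_l q⟩ = -⟨X, A_l w⟩`. Inserting this
in `[X, Y] = dY X - dX Y` and using skewness yields `⟨[X, Y], A_l q⟩ = 2 ⟨X, A_l Y⟩`. -/
theorem isCurvatureAt_frameSpan_orthogonal (q : S7) :
    IsCurvatureAt (fun z => (frameSpan A z)ᗮ) q
      (frameOrthogonalCurvature A q) := by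
  constructor
  · intro X Y hX hY
    have hX' := mdifferentiableAt_dIncl hX.mdifferentiableAt
    have hY' := mdifferentiableAt_dIncl hY.mdifferentiableAt
    have key : ∀ X : ∀ z : S7, TangentSpace (𝓡 7) z,
        (inducedStructure fun z => (frameSpan A z)ᗮ).IsHorizontalFieldNear q X → ∀ l w,
        inner ℝ (mvfderiv (𝓡 7) (fun z => dIncl z (X z)) q w) (A l (q : QuaternionPlane)) =
          - inner ℝ (dIncl q (X q)) (A l (dIncl q w)) := by
      intro X hX l w
      have hX' := mdifferentiableAt_dIncl hX.mdifferentiableAt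
      have hG : HasFDerivAt (fun p : QuaternionPlane × QuaternionPlane => inner ℝ p.1 (A l p.2)) _
          (dIncl q (X q), (q : QuaternionPlane)) :=
        hasFDerivAt_fst.inner ℝ ((A l).hasFDerivAt.comp _ hasFDerivAt_snd)
      have h1 := mvfderiv_comp_prodMk_coe hX' hG w
      obtain ⟨U, hU, hqU, -, hXU⟩ := hX
      have h2 : (fun z : S7 => inner ℝ (dIncl z (X z)) (A l (z : QuaternionPlane))) =ᶠ[nhds q]
          fun _ => (0 : ℝ) := by
        filter_upwards [hU.mem_nhds hqU] with z hz
        exact mem_frameSpan_orthogonal.1 (hXU z hz) l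
      rw [mvfderiv_congr h2, mvfderiv_const] at h1
      simp [-WithLp.prod_inner_apply] at h1
      linarith
    rw [mem_tangentPart]
    constructor
    · rw [mem_frameSpan_orthogonal]
      intro l
      rw [dIncl_mlieBracket hX.mdifferentiableAt hY.mdifferentiableAt, inner_sub_left,
        inner_sub_left, key X hX, key Y hY]
      have := hA.skew l (dIncl q (X q)) (dIncl q (Y q))
      rw [real_inner_comm] at this
      simp [frameOrthogonalCurvature, sum_inner, inner_smul_left, hA.orthonormal, -WithLp.prod_inner_apply]
      linarith
    · rw [inner_sub_right, inner_dIncl_eq_zero, frameOrthogonalCurvature, LinearMap.mk₂_apply, inner_sum, sub_eq_zero, eq_comm]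
      exact Finset.sum_eq_zero fun l _ => by rw [inner_smul_right, hA.inner_self_apply, mul_zero]
  · intro u hu
    -- The constant vector is made horizontal at each `z` by subtracting its radial part and its
    -- projection on the frame; both vanish at `q`.
    let Y : QuaternionPlane → QuaternionPlane := fun z =>
      dIncl q u - inner ℝ (dIncl q u) z • z - frameProj A (dIncl q u, z)
    have hYs : ContDiff ℝ ∞ Y := by
      refine (contDiff_const.sub ((contDiff_const.inner ℝ contDiff_id).smul contDiff_id)).sub ?_
      exact ContDiff.sum fun l _ =>
        (contDiff_const.inner ℝ (A l).contDiff).smul (A l).contDiff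
    have hYt : ∀ z : S7, inner ℝ (z : QuaternionPlane) (Y z) = 0 := by
      intro z
      simp only [Y, frameProj, inner_sub_right, inner_sum, inner_smul_right, hA.inner_self_apply,
        mul_zero, Finset.sum_const_zero, inner_self_eq_one]
      rw [real_inner_comm]
      ring
    obtain ⟨X, hX, hXY⟩ := exists_contMDiff_field_sphere (E := QuaternionPlane) (n := 7)
      (hYs.contMDiff.comp contMDiff_coe_sphere) hYt
    have hXY' : ∀ z, dIncl z (X z) = Y z := hXY
    refine ⟨X, ⟨Set.univ, isOpen_univ, trivial, hX.contMDiffOn, fun z _ => ?_⟩, ?_⟩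
    · change dIncl z (X z) ∈ (frameSpan A z)ᗮ
      rw [hXY', mem_frameSpan_orthogonal]
      intro l
      rw [inner_sub_left, hA.inner_frameProj, inner_sub_left, inner_smul_left, hA.inner_self_apply]
      ring
    · refine dIncl_injective q ?_
      have h0 : frameProj A (dIncl q u, (q : QuaternionPlane)) = 0 :=
        Finset.sum_eq_zero fun l _ => by
          rw [mem_frameSpan_orthogonal.1 hu l, zero_smul]
      rw [hXY']
      simp only [Y]
      rw [h0, real_inner_comm, inner_dIncl_eq_zero]
      simp

/-- A horizontal field satisfies `X = ∑ ⟨X, A_l z⟩ A_l z`. When this is differentiated, the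
derivatives of the coefficients contribute only horizontal vectors, so modulo the distribution `dX
w` is `∑ ⟨X, A_l q⟩ A_l w`. -/
theorem isCurvatureAt_frameSpan (q : S7) :
    IsCurvatureAt (frameSpan A) q
      (frameCurvature A q) := by
  constructor
  · intro X Y hX hY
    have key : ∀ X : ∀ z : S7, TangentSpace (𝓡 7) z,
        (inducedStructure (frameSpan A)).IsHorizontalFieldNear q X → ∀ w,
        mvfderiv (𝓡 7) (fun z => dIncl z (X z)) q w -
          ∑ l, inner ℝ (dIncl q (X q)) (A l (q : QuaternionPlane)) • A l (dIncl q w) ∈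
          frameSpan A q := by
      intro X hX w
      have hX' := mdifferentiableAt_dIncl hX.mdifferentiableAt
      have hG : HasFDerivAt (frameProj A) _ (dIncl q (X q), (q : QuaternionPlane)) :=
        HasFDerivAt.fun_sum (u := Finset.univ) fun l _ =>
          (hasFDerivAt_fst.inner ℝ ((A l).hasFDerivAt.comp _ hasFDerivAt_snd)).smul
            ((A l).hasFDerivAt.comp _ hasFDerivAt_snd)
      have h1 := mvfderiv_comp_prodMk_coe hX' hG w
      obtain ⟨U, hU, hqU, -, hXU⟩ := hX
      have h2 : (fun z : S7 => frameProj A (dIncl z (X z), (z : QuaternionPlane))) =ᶠ[nhds q]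
          fun z => dIncl z (X z) := by
        filter_upwards [hU.mem_nhds hqU] with z hz
        exact hA.frameProj_eq_self (hXU z hz)
      rw [mvfderiv_congr h2] at h1
      rw [h1]
      simp only [sum_apply, add_apply, Finset.sum_add_distrib]
      rw [add_comm, add_sub_assoc]
      refine Submodule.add_mem _ (Submodule.sum_mem _ fun l _ => ?_) ?_
      · exact Submodule.smul_mem _ _ (Submodule.subset_span ⟨l, rfl⟩)
      · convert Submodule.zero_mem _ using 1
        rw [sub_eq_zero]
        rfl
    rw [hA.tangentPart_frameSpan, dIncl_mlieBracket hX.mdifferentiableAt hY.mdifferentiableAt]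
    have := Submodule.sub_mem _ (key Y hY (X q)) (key X hX (Y q))
    convert this using 1
    rw [frameCurvature, LinearMap.mk₂_apply, Finset.sum_sub_distrib]
    abel
  · intro u hu
    let Y : QuaternionPlane → QuaternionPlane := fun z =>
      ∑ l, inner ℝ (dIncl q u) (A l (q : QuaternionPlane)) • A l z
    have hYs : ContDiff ℝ ∞ Y := ContDiff.sum fun l _ => (A l).contDiff.const_smul _
    have hYm : ∀ z : S7, Y z ∈ frameSpan A z := fun z => Submodule.sum_mem _ fun l _ =>
      Submodule.smul_mem _ _ (Submodule.subset_span ⟨l, rfl⟩)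
    have hYt : ∀ z : S7, inner ℝ (z : QuaternionPlane) (Y z) = 0 := fun z =>
      Submodule.mem_orthogonal_singleton_iff_inner_right.1 (hA.frameSpan_le z (hYm z))
    obtain ⟨X, hX, hXY⟩ := exists_contMDiff_field_sphere (E := QuaternionPlane) (n := 7)
      (hYs.contMDiff.comp contMDiff_coe_sphere) hYt
    have hXY' : ∀ z, dIncl z (X z) = Y z := hXY
    refine ⟨X, ⟨Set.univ, isOpen_univ, trivial, hX.contMDiffOn, fun z _ => ?_⟩, ?_⟩
    · change dIncl z (X z) ∈ frameSpan A z
      rw [hXY']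
      exact hYm z
    · refine dIncl_injective q ?_
      rw [hXY']
      exact hA.frameProj_eq_self hu

end IsSkewFrame

end S7

/-! ### The Hopf and Clifford frames in coordinates -/

namespace S7

/-- The quaternion with given coordinates. -/
def quat (a b c d : ℝ) : Quaternion ℝ := ⟨a, b, c, d⟩

@[simp] theorem quat_re (a b c d : ℝ) : (quat a b c d).re = a := rfl
@[simp] theorem quat_imI (a b c d : ℝ) : (quat a b c d).imI = b := rfl
@[simp] theorem quat_imJ (a b c d : ℝ) : (quat a b c d).imJ = c := rfl
@[simp] theorem quat_imK (a b c d : ℝ) : (quat a b c d).imK = d := rfl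

theorem qi_eq : qi = quat 0 1 0 0 := rfl
theorem qj_eq : qj = quat 0 0 1 0 := rfl
theorem qk_eq : qk = quat 0 0 0 1 := rfl

theorem fst_toLp (a b : Quaternion ℝ) : (WithLp.toLp 2 (a, b) : QuaternionPlane).fst = a := rfl
theorem snd_toLp (a b : Quaternion ℝ) : (WithLp.toLp 2 (a, b) : QuaternionPlane).snd = b := rfl

theorem inner_eq_sum_coords (u v : QuaternionPlane) : inner ℝ u v =
    u.fst.re * v.fst.re + u.fst.imI * v.fst.imI + u.fst.imJ * v.fst.imJ + u.fst.imK * v.fst.imK +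
    (u.snd.re * v.snd.re + u.snd.imI * v.snd.imI + u.snd.imJ * v.snd.imJ +
      u.snd.imK * v.snd.imK) := by
  simp [Quaternion.inner_def]

/-- `rightMul a` as a continuous linear map. -/
def rightMulL (a : Quaternion ℝ) : QuaternionPlane →L[ℝ] QuaternionPlane :=
  LinearMap.toContinuousLinearMap
    { toFun := rightMul a
      map_add' := fun u v => by simp [rightMul, add_mul, ← WithLp.toLp_add]
      map_smul' := fun c u => by simp [rightMul, ← WithLp.toLp_smul] }

/-- `crossMul b` as a continuous linear map. -/
def crossMulL (b : Quaternion ℝ) : QuaternionPlane →L[ℝ] QuaternionPlane :=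
  LinearMap.toContinuousLinearMap
    { toFun := crossMul b
      map_add' := fun u v => by simp [crossMul, add_mul, ← WithLp.toLp_add]
      map_smul' := fun c u => by simp [crossMul, ← WithLp.toLp_smul] }

/-- `rot` as a continuous linear map. -/
def rotL : QuaternionPlane →L[ℝ] QuaternionPlane :=
  LinearMap.toContinuousLinearMap
    { toFun := rot
      map_add' := fun u v => by simp [rot, ← WithLp.toLp_add, add_comm]
      map_smul' := fun c u => by simp [rot, ← WithLp.toLp_smul] }

/-- The fields `q ↦ q i, q j, q k`. -/
def hopfFrame : Fin 3 → QuaternionPlane →L[ℝ] QuaternionPlane :=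
  ![rightMulL qi, rightMulL qj, rightMulL qk]

/-- The Clifford fields `A_1, …, A_4`. -/
def cliffordFrame : Fin 4 → QuaternionPlane →L[ℝ] QuaternionPlane :=
  ![crossMulL qk, crossMulL qj, crossMulL (-qi), rotL]

theorem hopfFrame_0 (u : QuaternionPlane) : hopfFrame 0 u = WithLp.toLp 2
    (quat (-u.fst.imI) u.fst.re u.fst.imK (-u.fst.imJ),
      quat (-u.snd.imI) u.snd.re u.snd.imK (-u.snd.imJ)) := by
  change rightMul qi u = _
  simp only [rightMul, qi_eq]
  congr 2 <;> ext <;> simp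

theorem hopfFrame_1 (u : QuaternionPlane) : hopfFrame 1 u = WithLp.toLp 2
    (quat (-u.fst.imJ) (-u.fst.imK) u.fst.re u.fst.imI,
      quat (-u.snd.imJ) (-u.snd.imK) u.snd.re u.snd.imI) := by
  change rightMul qj u = _
  simp only [rightMul, qj_eq]
  congr 2 <;> ext <;> simp

theorem hopfFrame_2 (u : QuaternionPlane) : hopfFrame 2 u = WithLp.toLp 2
    (quat (-u.fst.imK) u.fst.imJ (-u.fst.imI) u.fst.re,
      quat (-u.snd.imK) u.snd.imJ (-u.snd.imI) u.snd.re) := by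
  change rightMul qk u = _
  simp only [rightMul, qk_eq]
  congr 2 <;> ext <;> simp

theorem cliffordFrame_0 (u : QuaternionPlane) : cliffordFrame 0 u = WithLp.toLp 2
    (quat (-u.snd.imK) u.snd.imJ (-u.snd.imI) u.snd.re,
      quat (-u.fst.imK) u.fst.imJ (-u.fst.imI) u.fst.re) := by
  change crossMul qk u = _
  simp only [crossMul, qk_eq]
  congr 2 <;> ext <;> simp

theorem cliffordFrame_1 (u : QuaternionPlane) : cliffordFrame 1 u = WithLp.toLp 2
    (quat (-u.snd.imJ) (-u.snd.imK) u.snd.re u.snd.imI,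
      quat (-u.fst.imJ) (-u.fst.imK) u.fst.re u.fst.imI) := by
  change crossMul qj u = _
  simp only [crossMul, qj_eq]
  congr 2 <;> ext <;> simp

theorem cliffordFrame_2 (u : QuaternionPlane) : cliffordFrame 2 u = WithLp.toLp 2
    (quat u.snd.imI (-u.snd.re) (-u.snd.imK) u.snd.imJ,
      quat u.fst.imI (-u.fst.re) (-u.fst.imK) u.fst.imJ) := by
  change crossMul (-qi) u = _
  simp only [crossMul, qi_eq]
  congr 2 <;> ext <;> simp

theorem cliffordFrame_3 (u : QuaternionPlane) :
    cliffordFrame 3 u = WithLp.toLp 2 (u.snd, -u.fst) := rfl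

theorem sum_sq_coords (q : S7) :
    (q : QuaternionPlane).fst.re ^ 2 + (q : QuaternionPlane).fst.imI ^ 2 +
      (q : QuaternionPlane).fst.imJ ^ 2 + (q : QuaternionPlane).fst.imK ^ 2 +
    ((q : QuaternionPlane).snd.re ^ 2 + (q : QuaternionPlane).snd.imI ^ 2 +
      (q : QuaternionPlane).snd.imJ ^ 2 + (q : QuaternionPlane).snd.imK ^ 2) = 1 := by
  have h := inner_self_eq_one q
  rw [inner_eq_sum_coords] at h
  linear_combination h

theorem isSkewFrame_hopfFrame : IsSkewFrame hopfFrame := by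
  constructor
  · intro l u v
    fin_cases l <;>
      simp only [Fin.zero_eta, Fin.mk_one, Fin.reduceFinMk, inner_eq_sum_coords, fst_toLp,
        snd_toLp, quat_re, quat_imI, quat_imJ, quat_imK, hopfFrame_0,
        hopfFrame_1, hopfFrame_2] <;> ring
  · intro q l m
    have h := sum_sq_coords q
    fin_cases l <;> fin_cases m <;>
      simp only [Fin.zero_eta, Fin.mk_one, Fin.reduceFinMk, inner_eq_sum_coords, fst_toLp,
        snd_toLp, quat_re, quat_imI, quat_imJ, quat_imK, hopfFrame_0,
        hopfFrame_1, hopfFrame_2, Fin.reduceEq, if_true, if_false] <;>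
      first | linear_combination h | ring

theorem isSkewFrame_cliffordFrame : IsSkewFrame cliffordFrame := by
  constructor
  · intro l u v
    fin_cases l <;>
      simp only [Fin.zero_eta, Fin.mk_one, Fin.reduceFinMk, inner_eq_sum_coords, fst_toLp,
        snd_toLp, quat_re, quat_imI, quat_imJ, quat_imK, cliffordFrame_0,
        cliffordFrame_1, cliffordFrame_2, cliffordFrame_3, Quaternion.re_neg, Quaternion.imI_neg,
        Quaternion.imJ_neg, Quaternion.imK_neg] <;> ring
  · intro q l m
    have h := sum_sq_coords q
    fin_cases l <;> fin_cases m <;>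
      simp only [Fin.zero_eta, Fin.mk_one, Fin.reduceFinMk, inner_eq_sum_coords, fst_toLp,
        snd_toLp, quat_re, quat_imI, quat_imJ, quat_imK, cliffordFrame_0,
        cliffordFrame_1, cliffordFrame_2, cliffordFrame_3, Quaternion.re_neg, Quaternion.imI_neg,
        Quaternion.imJ_neg, Quaternion.imK_neg, Fin.reduceEq, if_true, if_false] <;>
      first | linear_combination h | ring

theorem quaternionic_eq : quaternionic = inducedStructure fun q => (frameSpan hopfFrame q)ᗮ := by
  unfold quaternionic
  congr 1
  ext1 q
  congr 2
  ext w
  simp [hopfFrame, Fin.exists_fin_succ, eq_comm]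
  rfl

theorem trivializable_eq : trivializable = inducedStructure (frameSpan cliffordFrame) := by
  unfold trivializable frameSpan
  congr 1
  ext1 q
  congr 1
  ext w
  simp [cliffordFrame, Fin.exists_fin_succ, eq_comm]
  rfl

end S7

/-! ### The bracket form in the Clifford frame and its Pfaffian -/

namespace S7

theorem IsSkewFrame.inner_frameCurvature {ι : Type*} [Fintype ι] [DecidableEq ι]
    {A : ι → QuaternionPlane →L[ℝ] QuaternionPlane} (hA : IsSkewFrame A) (p : S7)
    (ζ : QuaternionPlane) (f : ι → ℝ) (j : ι) :
    inner ℝ ζ (frameCurvature A p (∑ i, f i • A i (p : QuaternionPlane))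
        (A j (p : QuaternionPlane))) =
      ∑ i, f i * inner ℝ ζ (A j (A i (p : QuaternionPlane)) - A i (A j (p : QuaternionPlane))) := by
  simp only [map_sum, map_smul, LinearMap.sum_apply, LinearMap.smul_apply, inner_sum,
    inner_smul_right]
  refine Finset.sum_congr rfl fun i _ => ?_
  congr 2
  rw [frameCurvature, LinearMap.mk₂_apply]
  simp only [hA.orthonormal, ite_smul, one_smul, zero_smul, Finset.sum_sub_distrib,
    Finset.sum_ite_eq, Finset.mem_univ, if_true]

/-- The product `x̄ ξ` for `p = (x, y)` and `ζ = (ξ, η)`. -/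
def fstProd (p ζ : QuaternionPlane) : Quaternion ℝ := star p.fst * ζ.fst

/-- The product `ȳ η` for `p = (x, y)` and `ζ = (ξ, η)`. -/
def sndProd (p ζ : QuaternionPlane) : Quaternion ℝ := star p.snd * ζ.snd

section Coordinates

variable (p ζ : QuaternionPlane)

theorem fstProd_imI : (fstProd p ζ).imI =
    p.fst.re * ζ.fst.imI - p.fst.imI * ζ.fst.re - p.fst.imJ * ζ.fst.imK + p.fst.imK * ζ.fst.imJ := by
  simp [fstProd, Quaternion.imI_mul]; ring

theorem fstProd_imJ : (fstProd p ζ).imJ =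
    p.fst.re * ζ.fst.imJ - p.fst.imJ * ζ.fst.re - p.fst.imK * ζ.fst.imI + p.fst.imI * ζ.fst.imK := by
  simp [fstProd, Quaternion.imJ_mul]; ring

theorem fstProd_imK : (fstProd p ζ).imK =
    p.fst.re * ζ.fst.imK - p.fst.imK * ζ.fst.re - p.fst.imI * ζ.fst.imJ + p.fst.imJ * ζ.fst.imI := by
  simp [fstProd, Quaternion.imK_mul]; ring

theorem sndProd_imI : (sndProd p ζ).imI =
    p.snd.re * ζ.snd.imI - p.snd.imI * ζ.snd.re - p.snd.imJ * ζ.snd.imK + p.snd.imK * ζ.snd.imJ := by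
  simp [sndProd, Quaternion.imI_mul]; ring

theorem sndProd_imJ : (sndProd p ζ).imJ =
    p.snd.re * ζ.snd.imJ - p.snd.imJ * ζ.snd.re - p.snd.imK * ζ.snd.imI + p.snd.imI * ζ.snd.imK := by
  simp [sndProd, Quaternion.imJ_mul]; ring

theorem sndProd_imK : (sndProd p ζ).imK =
    p.snd.re * ζ.snd.imK - p.snd.imK * ζ.snd.re - p.snd.imI * ζ.snd.imJ + p.snd.imJ * ζ.snd.imI := by
  simp [sndProd, Quaternion.imK_mul]; ring

/-- The matrix of the form `Z [·, ·]` in the frame `A_1, …, A_4`, where `Z = ⟨ζ, ·⟩`. -/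
def cliffordForm (i j : Fin 4) : ℝ :=
  inner ℝ ζ (cliffordFrame j (cliffordFrame i p) - cliffordFrame i (cliffordFrame j p))

theorem cliffordForm_self (i : Fin 4) : cliffordForm p ζ i i = 0 := by
  rw [cliffordForm, sub_self, inner_zero_right]

theorem cliffordForm_swap (i j : Fin 4) : cliffordForm p ζ j i = - cliffordForm p ζ i j := by
  rw [cliffordForm, cliffordForm, ← inner_neg_right, neg_sub]

/-- In this formula and the five that follow, complementary entries of the matrix involve the same
component of `Im (x̄ ξ)` and `Im (ȳ η)`. The first vector is the self-dual part and the second the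
anti-self-dual part, up to scale. -/
theorem cliffordForm_01 :
    cliffordForm p ζ 0 1 = -2 * ((fstProd p ζ).imI + (sndProd p ζ).imI) := by
  simp only [cliffordForm, inner_sub_right, inner_eq_sum_coords, cliffordFrame_0, cliffordFrame_1,
    fst_toLp, snd_toLp, quat_re, quat_imI, quat_imJ, quat_imK, fstProd_imI, sndProd_imI]
  ring

theorem cliffordForm_02 :
    cliffordForm p ζ 0 2 = -2 * ((fstProd p ζ).imJ + (sndProd p ζ).imJ) := by
  simp only [cliffordForm, inner_sub_right, inner_eq_sum_coords, cliffordFrame_0, cliffordFrame_2,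
    fst_toLp, snd_toLp, quat_re, quat_imI, quat_imJ, quat_imK, fstProd_imJ, sndProd_imJ]
  ring

theorem cliffordForm_12 :
    cliffordForm p ζ 1 2 = 2 * ((fstProd p ζ).imK + (sndProd p ζ).imK) := by
  simp only [cliffordForm, inner_sub_right, inner_eq_sum_coords, cliffordFrame_1, cliffordFrame_2,
    fst_toLp, snd_toLp, quat_re, quat_imI, quat_imJ, quat_imK, fstProd_imK, sndProd_imK]
  ring

theorem cliffordForm_03 :
    cliffordForm p ζ 0 3 = 2 * ((fstProd p ζ).imK - (sndProd p ζ).imK) := by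
  simp only [cliffordForm, inner_sub_right, inner_eq_sum_coords, cliffordFrame_0, cliffordFrame_3,
    fst_toLp, snd_toLp, quat_re, quat_imI, quat_imJ, quat_imK, Quaternion.re_neg,
    Quaternion.imI_neg, Quaternion.imJ_neg, Quaternion.imK_neg, fstProd_imK, sndProd_imK]
  ring

theorem cliffordForm_13 :
    cliffordForm p ζ 1 3 = 2 * ((fstProd p ζ).imJ - (sndProd p ζ).imJ) := by
  simp only [cliffordForm, inner_sub_right, inner_eq_sum_coords, cliffordFrame_1, cliffordFrame_3,
    fst_toLp, snd_toLp, quat_re, quat_imI, quat_imJ, quat_imK, Quaternion.re_neg,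
    Quaternion.imI_neg, Quaternion.imJ_neg, Quaternion.imK_neg, fstProd_imJ, sndProd_imJ]
  ring

theorem cliffordForm_23 :
    cliffordForm p ζ 2 3 = -2 * ((fstProd p ζ).imI - (sndProd p ζ).imI) := by
  simp only [cliffordForm, inner_sub_right, inner_eq_sum_coords, cliffordFrame_2, cliffordFrame_3,
    fst_toLp, snd_toLp, quat_re, quat_imI, quat_imJ, quat_imK, Quaternion.re_neg,
    Quaternion.imI_neg, Quaternion.imJ_neg, Quaternion.imK_neg, fstProd_imI, sndProd_imI]
  ring

/-- The sum of the squares of the coordinates of a quaternion. -/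
def sumSq (a : Quaternion ℝ) : ℝ := a.re ^ 2 + a.imI ^ 2 + a.imJ ^ 2 + a.imK ^ 2

theorem sumSq_eq (a : Quaternion ℝ) : sumSq a = ‖a‖ ^ 2 := by
  rw [sq, ← Quaternion.normSq_eq_norm_mul_self, Quaternion.normSq_def']
  rfl

variable {p ζ}

/-- Orthogonality to the `A_l p` says that `x̄ η` is the conjugate of `ȳ ξ`, whence `|x|² |η|² =
|y|² |ξ|²`. Orthogonality to `p` says that `x̄ ξ` and `ȳ η` have opposite real parts, so those
squares cancel and the left side is `|x|² |ξ|² - |y|² |η|²`. -/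
theorem imaginary_sub_eq (h : inner ℝ p ζ = 0) (hA : ∀ l, inner ℝ ζ (cliffordFrame l p) = 0) :
    ((fstProd p ζ).imI ^ 2 + (fstProd p ζ).imJ ^ 2 + (fstProd p ζ).imK ^ 2) -
      ((sndProd p ζ).imI ^ 2 + (sndProd p ζ).imJ ^ 2 + (sndProd p ζ).imK ^ 2) =
    (sumSq p.fst - sumSq p.snd) * (sumSq ζ.fst + sumSq ζ.snd) := by
  have h0 := hA 0
  have h1 := hA 1
  have h2 := hA 2
  have h3 := hA 3
  simp only [inner_eq_sum_coords, cliffordFrame_0, cliffordFrame_1, cliffordFrame_2,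
    cliffordFrame_3, fst_toLp, snd_toLp, quat_re, quat_imI, quat_imJ, quat_imK, Quaternion.re_neg,
    Quaternion.imI_neg, Quaternion.imJ_neg, Quaternion.imK_neg] at h h0 h1 h2 h3
  simp only [fstProd_imI, fstProd_imJ, fstProd_imK, sndProd_imI, sndProd_imJ, sndProd_imK, sumSq]
  generalize p.fst.re = x0 at *
  generalize p.fst.imI = x1 at *
  generalize p.fst.imJ = x2 at *
  generalize p.fst.imK = x3 at *
  generalize p.snd.re = y0 at *
  generalize p.snd.imI = y1 at *
  generalize p.snd.imJ = y2 at *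
  generalize p.snd.imK = y3 at *
  generalize ζ.fst.re = a0 at *
  generalize ζ.fst.imI = a1 at *
  generalize ζ.fst.imJ = a2 at *
  generalize ζ.fst.imK = a3 at *
  generalize ζ.snd.re = b0 at *
  generalize ζ.snd.imI = b1 at *
  generalize ζ.snd.imJ = b2 at *
  generalize ζ.snd.imK = b3 at *
  linear_combination
    ((y0 * b0 + y1 * b1 + y2 * b2 + y3 * b3) - (x0 * a0 + x1 * a1 + x2 * a2 + x3 * a3)) * h +
    ((x0 * b0 + x1 * b1 + x2 * b2 + x3 * b3) + (y0 * a0 + y1 * a1 + y2 * a2 + y3 * a3)) * h3 -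
    ((x0 * b3 - x3 * b0 - x1 * b2 + x2 * b1) - (y0 * a3 - y3 * a0 - y1 * a2 + y2 * a1)) * h0 -
    ((x0 * b2 - x2 * b0 - x3 * b1 + x1 * b3) - (y0 * a2 - y2 * a0 - y3 * a1 + y1 * a3)) * h1 +
    ((x0 * b1 - x1 * b0 - x2 * b3 + x3 * b2) - (y0 * a1 - y1 * a0 - y2 * a3 + y3 * a2)) * h2

variable (p)

/-- A vector orthogonal to the trivializable distribution. -/
def conormal : QuaternionPlane :=
  -- For `ξ = |x|² x i`, the condition `x̄ η = ξ̄ y` is solved by `η = -x i x̄ y`. The factor `|x|²`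
  -- avoids dividing by it.
  WithLp.toLp 2 (sumSq p.fst • (p.fst * qi), -(p.fst * qi * star p.fst * p.snd))

theorem conormal_coords :
    ((conormal p).fst.re = - sumSq p.fst * p.fst.imI ∧
    (conormal p).fst.imI = sumSq p.fst * p.fst.re ∧
    (conormal p).fst.imJ = sumSq p.fst * p.fst.imK ∧
    (conormal p).fst.imK = - sumSq p.fst * p.fst.imJ) := by
  simp [conormal, qi_eq, Quaternion.re_mul]

theorem fstProd_conormal : (fstProd p (conormal p)).imI = sumSq p.fst ^ 2 ∧
    (fstProd p (conormal p)).imJ = 0 ∧ (fstProd p (conormal p)).imK = 0 := by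
  obtain ⟨h0, h1, h2, h3⟩ := conormal_coords p
  rw [fstProd_imI, fstProd_imJ, fstProd_imK, h0, h1, h2, h3]
  refine ⟨?_, ?_, ?_⟩ <;> simp only [sumSq] <;> ring

theorem inner_conormal : inner ℝ p (conormal p) = 0 := by
  rw [inner_eq_sum_coords]
  simp only [conormal, qi_eq, fst_toLp, snd_toLp, Quaternion.re_mul, Quaternion.imI_mul,
    Quaternion.imJ_mul, Quaternion.imK_mul, quat_re, quat_imI, quat_imJ, quat_imK,
    Quaternion.re_neg, Quaternion.imI_neg, Quaternion.imJ_neg, Quaternion.imK_neg,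
    Quaternion.re_smul, Quaternion.imI_smul, Quaternion.imJ_smul, Quaternion.imK_smul,
    Quaternion.re_star, Quaternion.imI_star, Quaternion.imJ_star, Quaternion.imK_star, smul_eq_mul,
    sumSq]
  ring

theorem inner_conormal_cliffordFrame (l : Fin 4) :
    inner ℝ (conormal p) (cliffordFrame l p) = 0 := by
  rw [inner_eq_sum_coords]
  fin_cases l <;>
  simp only [Fin.zero_eta, Fin.mk_one, Fin.reduceFinMk, cliffordFrame_0, cliffordFrame_1,
    cliffordFrame_2, cliffordFrame_3,
    conormal, qi_eq, fst_toLp, snd_toLp, Quaternion.re_mul, Quaternion.imI_mul,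
    Quaternion.imJ_mul, Quaternion.imK_mul, quat_re, quat_imI, quat_imJ, quat_imK,
    Quaternion.re_neg, Quaternion.imI_neg, Quaternion.imJ_neg, Quaternion.imK_neg,
    Quaternion.re_smul, Quaternion.imI_smul, Quaternion.imJ_smul, Quaternion.imK_smul,
    Quaternion.re_star, Quaternion.imI_star, Quaternion.imJ_star, Quaternion.imK_star, smul_eq_mul,
    sumSq] <;>
  ring

theorem sumSq_conormal : sumSq (conormal p).fst + sumSq (conormal p).snd =
    sumSq p.fst ^ 2 * (sumSq p.fst + sumSq p.snd) := by
  simp only [sumSq_eq, conormal, fst_toLp, snd_toLp, norm_neg, norm_mul, norm_smul, norm_star,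
    norm_pow, norm_norm]
  have h : ‖qi‖ ^ 2 = 1 := by rw [← sumSq_eq]; simp [sumSq, qi_eq]
  linear_combination (‖p.fst‖ ^ 6 + ‖p.fst‖ ^ 4 * ‖p.snd‖ ^ 2) * h

end Coordinates

/-- A skew 4 × 4 matrix times its Pfaffian adjoint is, up to sign, the Pfaffian times the identity.
The coefficients below are the entries of that adjoint. -/
theorem eq_zero_of_pfaffian_ne_zero {m : Fin 4 → Fin 4 → ℝ} (hs : ∀ i j, m j i = - m i j)
    (hPf : m 0 1 * m 2 3 - m 0 2 * m 1 3 + m 0 3 * m 1 2 ≠ 0) {f : Fin 4 → ℝ}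
    (hf : ∀ j, ∑ i, f i * m i j = 0) : f = 0 := by
  have hd : ∀ i, m i i = 0 := fun i => by linarith [hs i i]
  have h0 := hf 0
  have h1 := hf 1
  have h2 := hf 2
  have h3 := hf 3
  rw [Fin.sum_univ_four] at h0 h1 h2 h3
  rw [hd, hs 0 1, hs 0 2, hs 0 3] at h0
  rw [hd, hs 1 2, hs 1 3] at h1
  rw [hd, hs 2 3] at h2
  rw [hd] at h3
  ext i
  refine (mul_eq_zero.1 ?_).resolve_left hPf
  fin_cases i <;> simp only [Fin.zero_eta, Fin.mk_one, Fin.reduceFinMk]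
  · linear_combination m 2 3 * h1 - m 1 3 * h2 + m 1 2 * h3
  · linear_combination (-m 2 3) * h0 + m 0 3 * h2 - m 0 2 * h3
  · linear_combination m 1 3 * h0 - m 0 3 * h1 + m 0 1 * h3
  · linear_combination (-m 1 2) * h0 + m 0 2 * h1 - m 0 1 * h2

end S7

/-! ### The square of `J_Z` for the quaternionic structure -/

namespace S7

/-- Horizontal spaces are stable under right multiplication by `i, j, k`: moving one unit across the
inner product leaves the pairing of `a` with `q` or with `q i, q j, q k`, up to sign, and these all
vanish. -/
theorem inner_hopfFrame_eq_zero {q : S7} {a : QuaternionPlane}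
    (ha : a ∈ tangentPart (fun z => (frameSpan hopfFrame z)ᗮ) q) (j l : Fin 3) :
    inner ℝ (hopfFrame j a) (hopfFrame l (q : QuaternionPlane)) = 0 := by
  obtain ⟨h, hq⟩ := mem_tangentPart.1 ha
  rw [mem_frameSpan_orthogonal] at h
  have h0 := h 0
  have h1 := h 1
  have h2 := h 2
  rw [inner_eq_sum_coords] at h0 h1 h2 hq ⊢
  simp only [hopfFrame_0, hopfFrame_1, hopfFrame_2, fst_toLp, snd_toLp, quat_re, quat_imI,
    quat_imJ, quat_imK] at h0 h1 h2
  fin_cases j <;> fin_cases l <;>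
  simp only [Fin.zero_eta, Fin.mk_one, Fin.reduceFinMk, hopfFrame_0, hopfFrame_1, hopfFrame_2,
    fst_toLp, snd_toLp, quat_re, quat_imI, quat_imJ, quat_imK] <;>
  first
    | linear_combination hq
    | linear_combination h0
    | linear_combination h1
    | linear_combination h2
    | linear_combination (-1) * h0
    | linear_combination (-1) * h1
    | linear_combination (-1) * h2

/-- The operators `J_Z` of the quaternionic contact structure satisfy `J_Z ^ 2 = - c`. -/
theorem exists_sq_frameOrthogonalCurvature_hopfFrame {q : S7} {ξ : QuaternionPlane}
    (hξ : inner ℝ (q : QuaternionPlane) ξ = 0) :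
    ∃ c : ℝ, (ξ ≠ 0 → (∀ a ∈ tangentPart (fun z => (frameSpan hopfFrame z)ᗮ) q, inner ℝ ξ a = 0) →
        c ≠ 0) ∧
      ∀ a ∈ tangentPart (fun z => (frameSpan hopfFrame z)ᗮ) q,
        ∃ a' ∈ tangentPart (fun z => (frameSpan hopfFrame z)ᗮ) q, ∀ b,
          inner ℝ ξ (frameOrthogonalCurvature hopfFrame q a b) = inner ℝ a' b ∧
          inner ℝ ξ (frameOrthogonalCurvature hopfFrame q a' b) = -c * inner ℝ a b := by
  set c : Fin 3 → ℝ := fun i => inner ℝ ξ (hopfFrame i (q : QuaternionPlane)) with hc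
  have hω : ∀ a b, inner ℝ ξ (frameOrthogonalCurvature hopfFrame q a b) =
      ∑ i, 2 * inner ℝ a (hopfFrame i b) * c i := fun a b => by
    rw [frameOrthogonalCurvature, LinearMap.mk₂_apply, inner_sum]
    simp only [inner_smul_right, hc]
  refine ⟨4 * ∑ i, c i ^ 2, fun hξ0 hξH h0 => hξ0 ?_, fun a ha => ?_⟩
  · have hc0 : ∀ i, c i = 0 := fun i => by
      have h1 : ∑ i, c i ^ 2 = 0 := by linarith
      rw [Finset.sum_eq_zero_iff_of_nonneg fun i _ => sq_nonneg (c i)] at h1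
      exact pow_eq_zero_iff two_ne_zero |>.1 (h1 i (Finset.mem_univ i))
    exact inner_self_eq_zero.1 (hξH ξ (mem_tangentPart.2 ⟨mem_frameSpan_orthogonal.2 hc0, hξ⟩))
  -- By skewness of the frame this vector is `J_Z a`.
  · refine ⟨∑ j, (-2 * c j) • hopfFrame j a, mem_tangentPart.2 ⟨mem_frameSpan_orthogonal.2 fun l => ?_,
      ?_⟩, fun b => ⟨?_, ?_⟩⟩
    · rw [sum_inner]
      exact Finset.sum_eq_zero fun j _ => by
        rw [inner_smul_left, inner_hopfFrame_eq_zero ha, mul_zero]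
    · rw [inner_sum]
      exact Finset.sum_eq_zero fun j _ => by
        rw [inner_smul_right, real_inner_comm, isSkewFrame_hopfFrame.skew,
          mem_frameSpan_orthogonal.1 (mem_tangentPart.1 ha).1, neg_zero, mul_zero]
    · rw [hω, sum_inner]
      refine Finset.sum_congr rfl fun j _ => ?_
      rw [inner_smul_left, isSkewFrame_hopfFrame.skew, RCLike.conj_to_real]
      ring
    -- Right multiplications by `i, j, k` anticommute and square to `-1`, so the mixed terms cancel
    -- and `4 * ∑ c i ^ 2` remains.
    · rw [hω]
      simp only [sum_inner, inner_smul_left, RCLike.conj_to_real]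
      simp only [Fin.sum_univ_three]
      generalize c 0 = c0
      generalize c 1 = c1
      generalize c 2 = c2
      simp only [inner_eq_sum_coords, hopfFrame_0, hopfFrame_1, hopfFrame_2, fst_toLp, snd_toLp,
        quat_re, quat_imI, quat_imJ, quat_imK]
      ring

theorem quaternionic_nonsingularAt (q : S7) : quaternionic.NonsingularAt q := by
  rw [quaternionic_eq]
  refine (isSkewFrame_hopfFrame.isCurvatureAt_frameSpan_orthogonal q).nonsingularAt
    fun ξ hξ hξH hξ0 a ha ha0 => ?_
  obtain ⟨c, hc, h⟩ := exists_sq_frameOrthogonalCurvature_hopfFrame hξ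
  obtain ⟨a', ha', hb⟩ := h a ha
  -- The form pairs `a` with `J a` to `|J a|²`, and `J a = 0` would contradict `J ^ 2 = -c` with `c
  -- ≠ 0`.
  refine ⟨a', ha', fun h0 => ?_⟩
  rw [(hb a').1, inner_self_eq_zero] at h0
  have h1 := (hb a).2
  rw [h0, map_zero, LinearMap.zero_apply, inner_zero_right, eq_comm, mul_eq_zero, neg_eq_zero,
    inner_self_eq_zero] at h1
  exact h1.elim (hc hξ0 hξH) ha0

/-! ### Singular points of the trivializable structure -/

theorem cliffordFrame_mem (p : S7) (l : Fin 4) :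
    cliffordFrame l (p : QuaternionPlane) ∈ frameSpan cliffordFrame p :=
  Submodule.subset_span ⟨l, rfl⟩

theorem inner_sum_cliffordFrame (p : S7) (f : Fin 4 → ℝ) (j : Fin 4) :
    inner ℝ (∑ i, f i • cliffordFrame i (p : QuaternionPlane))
      (cliffordFrame j (p : QuaternionPlane)) = f j := by
  simp [sum_inner, inner_smul_left, isSkewFrame_cliffordFrame.orthonormal, -WithLp.prod_inner_apply]

theorem inner_frameCurvature_sum (p : S7) (ζ : QuaternionPlane) (f : Fin 4 → ℝ) (j : Fin 4) :
    inner ℝ ζ (frameCurvature cliffordFrame p (∑ i, f i • cliffordFrame i (p : QuaternionPlane))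
      (cliffordFrame j (p : QuaternionPlane))) = ∑ i, f i * cliffordForm p ζ i j :=
  isSkewFrame_cliffordFrame.inner_frameCurvature p ζ f j

theorem inner_frameCurvature_cliffordFrame (p : S7) (ζ : QuaternionPlane) (i j : Fin 4) :
    inner ℝ ζ (frameCurvature cliffordFrame p (cliffordFrame i (p : QuaternionPlane))
      (cliffordFrame j (p : QuaternionPlane))) = cliffordForm p ζ i j := by
  have h := inner_frameCurvature_sum p ζ (fun l => if l = i then 1 else 0) j
  simpa [-WithLp.prod_inner_apply] using h

theorem sumSq_add_sumSq (p : S7) :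
    sumSq (p : QuaternionPlane).fst + sumSq (p : QuaternionPlane).snd = 1 :=
  sum_sq_coords p

theorem pfaffian_cliffordForm {p : S7} {ζ : QuaternionPlane}
    (hζp : inner ℝ (p : QuaternionPlane) ζ = 0)
    (hζ : ∀ a ∈ frameSpan cliffordFrame p, inner ℝ ζ a = 0) :
    cliffordForm p ζ 0 1 * cliffordForm p ζ 2 3 - cliffordForm p ζ 0 2 * cliffordForm p ζ 1 3 +
      cliffordForm p ζ 0 3 * cliffordForm p ζ 1 2 =
    4 * ((sumSq (p : QuaternionPlane).fst - sumSq (p : QuaternionPlane).snd) *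
      (sumSq ζ.fst + sumSq ζ.snd)) := by
  rw [← imaginary_sub_eq hζp fun l => hζ _ (cliffordFrame_mem p l), cliffordForm_01,
    cliffordForm_02, cliffordForm_03, cliffordForm_12, cliffordForm_13, cliffordForm_23]
  ring

theorem exists_inner_frameCurvature_ne_zero {p : S7}
    (hp : sumSq (p : QuaternionPlane).fst ≠ sumSq (p : QuaternionPlane).snd) {ζ : QuaternionPlane}
    (hζp : inner ℝ (p : QuaternionPlane) ζ = 0)
    (hζ : ∀ a ∈ frameSpan cliffordFrame p, inner ℝ ζ a = 0) (hζ0 : ζ ≠ 0)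
    {a : QuaternionPlane} (ha : a ∈ frameSpan cliffordFrame p) (ha0 : a ≠ 0) :
    ∃ b ∈ frameSpan cliffordFrame p, inner ℝ ζ (frameCurvature cliffordFrame p a b) ≠ 0 := by
  by_contra! hcon
  obtain ⟨f, rfl⟩ := (Submodule.mem_span_range_iff_exists_fun ℝ).1 ha
  refine ha0 ?_
  have hζs : sumSq ζ.fst + sumSq ζ.snd ≠ 0 := fun h => hζ0 (inner_self_eq_zero (𝕜 := ℝ).1 (by
    rw [inner_eq_sum_coords]
    simp only [sumSq] at h
    linear_combination h))
  have hf : f = 0 := by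
    refine eq_zero_of_pfaffian_ne_zero (m := cliffordForm p ζ) (cliffordForm_swap _ _) ?_ fun j => ?_
    · rw [pfaffian_cliffordForm hζp hζ]
      exact mul_ne_zero four_ne_zero (mul_ne_zero (sub_ne_zero.2 hp) hζs)
    · rw [← inner_frameCurvature_sum]
      exact hcon _ (cliffordFrame_mem p j)
  simp [hf]

theorem inner_conormal_of_mem (p : S7) :
    ∀ a ∈ frameSpan cliffordFrame p, inner ℝ (conormal p) a = 0 := by
  intro a ha
  obtain ⟨f, rfl⟩ := (Submodule.mem_span_range_iff_exists_fun ℝ).1 ha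
  rw [inner_sum]
  exact Finset.sum_eq_zero fun l _ => by
    rw [inner_smul_right, inner_conormal_cliffordFrame, mul_zero]

/-- At `|x| = |y|` the Pfaffian vanishes for every conormal covector, so a nonzero row of the
Pfaffian adjoint gives a kernel vector. The second assertion shows that `conormal p` is nonzero on
brackets. -/
theorem exists_kernel_frameCurvature {p : S7}
    (hp : sumSq (p : QuaternionPlane).fst = sumSq (p : QuaternionPlane).snd) :
    (∃ a ∈ frameSpan cliffordFrame p, a ≠ 0 ∧ ∀ b ∈ frameSpan cliffordFrame p,
      inner ℝ (conormal p) (frameCurvature cliffordFrame p a b) = 0) ∧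
    ∃ b ∈ frameSpan cliffordFrame p, ∃ c ∈ frameSpan cliffordFrame p,
      inner ℝ (conormal p) (frameCurvature cliffordFrame p b c) ≠ 0 := by
  set m := cliffordForm p (conormal p) with hm
  have hs : ∀ i j, m j i = - m i j := cliffordForm_swap _ _
  have hd : ∀ i, m i i = 0 := cliffordForm_self _ _
  have hPf := pfaffian_cliffordForm (inner_conormal (p : QuaternionPlane)) (inner_conormal_of_mem p)
  rw [hp, sub_self, zero_mul, mul_zero, ← hm] at hPf
  have key : ∀ f : Fin 4 → ℝ, f ≠ 0 → (∀ j, ∑ i, f i * m i j = 0) →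
      ∃ a ∈ frameSpan cliffordFrame p, a ≠ 0 ∧ ∀ b ∈ frameSpan cliffordFrame p,
      inner ℝ (conormal p) (frameCurvature cliffordFrame p a b) = 0 := by
    intro f hf h
    refine ⟨∑ i, f i • cliffordFrame i (p : QuaternionPlane),
      Submodule.sum_mem _ fun l _ => Submodule.smul_mem _ _ (cliffordFrame_mem p l),
      fun h0 => hf ?_, fun b hb => ?_⟩
    · ext j
      rw [← inner_sum_cliffordFrame p f j, h0, inner_zero_left, Pi.zero_apply]
    · obtain ⟨g, rfl⟩ := (Submodule.mem_span_range_iff_exists_fun ℝ).1 hb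
      rw [map_sum, inner_sum]
      refine Finset.sum_eq_zero fun j _ => ?_
      rw [map_smul, inner_smul_right, inner_frameCurvature_sum, ← hm, h, mul_zero]
  -- The sum isolates the self-dual component `|x|⁴`, where `|x|² = 1 / 2`. Hence one of the two
  -- entries is nonzero, and it appears in the kernel vector chosen below.
  have hsum : m 0 1 + m 2 3 ≠ 0 := by
    have h1 : m 0 1 + m 2 3 = -4 * sumSq (p : QuaternionPlane).fst ^ 2 := by
      rw [hm, cliffordForm_01, cliffordForm_23, ← (fstProd_conormal (p : QuaternionPlane)).1]
      ring
    have h2 := sumSq_add_sumSq p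
    rw [← hp] at h2
    rw [h1, show sumSq (p : QuaternionPlane).fst = 1 / 2 by linarith]
    norm_num
  by_cases h01 : m 0 1 = 0
  · have h23 : m 2 3 ≠ 0 := fun h => hsum (by rw [h01, h, add_zero])
    refine ⟨key ![0, - m 2 3, m 1 3, - m 1 2] (fun h => ?_) fun j => ?_, _, cliffordFrame_mem p 2, _,
      cliffordFrame_mem p 3, by rwa [inner_frameCurvature_cliffordFrame]⟩
    · exact h23 (neg_eq_zero.1 (congrFun h 1))
    · rw [Fin.sum_univ_four]
      fin_cases j <;> simp [hd, hs 0 1, hs 0 2, hs 0 3, hs 1 2, hs 1 3, hs 2 3] <;>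
      first | ring1 | linear_combination hPf
  · refine ⟨key ![m 1 2, - m 0 2, m 0 1, 0] (fun h => ?_) fun j => ?_, _, cliffordFrame_mem p 0, _,
      cliffordFrame_mem p 1, by rwa [inner_frameCurvature_cliffordFrame]⟩
    · exact h01 (congrFun h 2)
    · rw [Fin.sum_univ_four]
      fin_cases j <;> simp [hd, hs 0 1, hs 0 2, hs 0 3, hs 1 2, hs 1 3, hs 2 3] <;>
      first | ring1 | linear_combination hPf

theorem trivializable_nonsingularAt_iff (q : S7) : trivializable.NonsingularAt q ↔
    ‖(q : QuaternionPlane).fst‖ ≠ ‖(q : QuaternionPlane).snd‖ := by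
  have hn : ‖(q : QuaternionPlane).fst‖ = ‖(q : QuaternionPlane).snd‖ ↔
      sumSq (q : QuaternionPlane).fst = sumSq (q : QuaternionPlane).snd := by
    rw [sumSq_eq, sumSq_eq, sq_eq_sq₀ (norm_nonneg _) (norm_nonneg _)]
  have hcurv := isSkewFrame_cliffordFrame.isCurvatureAt_frameSpan q
  have ht := isSkewFrame_cliffordFrame.tangentPart_frameSpan q
  rw [trivializable_eq, ne_eq, hn]
  constructor
  · intro h hq
    obtain ⟨⟨a, ha, ha0, hab⟩, hne⟩ := exists_kernel_frameCurvature hq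
    rw [← ht] at ha hab hne
    exact hcurv.not_nonsingularAt (by rw [ht]; exact inner_conormal_of_mem q) ha ha0 hab hne h
  · intro h
    refine hcurv.nonsingularAt ?_
    rw [ht]
    exact fun ζ hζq hζ hζ0 a ha ha0 => exists_inner_frameCurvature_ne_zero h hζq hζ hζ0 ha ha0

/-- Let `m` be the matrix of the form, with self-dual part `a = (|x|⁴, 0, 0)` and anti-self-dual
part `b`. The entries of `m ^ 2 = -c` make the products of `|x|⁴` with the components of `b` vanish,
so `b = 0`. The identity `imaginary_sub_eq` then becomes `|x|⁴ |y|⁴ = 0`. -/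
theorem not_exists_sq_frameCurvature {p : S7} (hx : sumSq (p : QuaternionPlane).fst ≠ 0)
    (hy : sumSq (p : QuaternionPlane).snd ≠ 0) (c : ℝ)
    (h : ∀ a ∈ frameSpan cliffordFrame p, ∃ a' ∈ frameSpan cliffordFrame p,
      ∀ b ∈ frameSpan cliffordFrame p,
        inner ℝ (conormal p) (frameCurvature cliffordFrame p a b) = inner ℝ a' b ∧
        inner ℝ (conormal p) (frameCurvature cliffordFrame p a' b) = -c * inner ℝ a b) : False := by
  set m := cliffordForm p (conormal p) with hm
  have hs : ∀ i j, m j i = - m i j := cliffordForm_swap _ _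
  have hd : ∀ i, m i i = 0 := cliffordForm_self _ _
  have hsq : ∀ l k, ∑ i, m l i * m i k = if l = k then -c else 0 := by
    intro l k
    obtain ⟨a', ha', hb⟩ := h _ (cliffordFrame_mem p l)
    obtain ⟨f, rfl⟩ := (Submodule.mem_span_range_iff_exists_fun ℝ).1 ha'
    have hf : ∀ j, m l j = f j := fun j => by
      have := (hb _ (cliffordFrame_mem p j)).1
      rwa [inner_frameCurvature_cliffordFrame, inner_sum_cliffordFrame] at this
    have := (hb _ (cliffordFrame_mem p k)).2
    rw [inner_frameCurvature_sum, isSkewFrame_cliffordFrame.orthonormal, ← hm] at this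
    simp only [hf, this, mul_ite, mul_one, mul_zero]
  have h00 := hsq 0 0
  have h22 := hsq 2 2
  have h02 := hsq 0 2
  have h03 := hsq 0 3
  rw [Fin.sum_univ_four, hd, hs 0 1, hs 0 2, hs 0 3, if_pos rfl] at h00
  rw [Fin.sum_univ_four, hd, hs 0 2, hs 1 2, hs 2 3, if_pos rfl] at h22
  rw [Fin.sum_univ_four, hd, hd, hs 2 3, if_neg (by decide)] at h02
  rw [Fin.sum_univ_four, hd, hd, if_neg (by decide)] at h03
  obtain ⟨aI, aJ, aK⟩ := fstProd_conormal (p : QuaternionPlane)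
  have him := imaginary_sub_eq (inner_conormal (p : QuaternionPlane))
    (inner_conormal_cliffordFrame (p : QuaternionPlane))
  simp only [hm, cliffordForm_01, cliffordForm_02, cliffordForm_03, cliffordForm_12,
    cliffordForm_13, cliffordForm_23, aI, aJ, aK] at h00 h22 h02 h03
  rw [aI, aJ, aK, sumSq_conormal, sumSq_add_sumSq] at him
  have h1 := sumSq_add_sumSq p
  set X := sumSq (p : QuaternionPlane).fst
  set Y := sumSq (p : QuaternionPlane).snd
  have hX : X ^ 2 ≠ 0 := pow_ne_zero 2 hx
  have bI : (sndProd p (conormal p)).imI = 0 :=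
    (mul_eq_zero.1 (by linear_combination (h22 - h00) / 16 :
      X ^ 2 * (sndProd p (conormal p)).imI = 0)).resolve_left hX
  have bK : (sndProd p (conormal p)).imK = 0 := by
    rw [bI] at h02
    exact (mul_eq_zero.1 (by linear_combination - h02 / 8 :
      X ^ 2 * (sndProd p (conormal p)).imK = 0)).resolve_left hX
  have bJ : (sndProd p (conormal p)).imJ = 0 := by
    rw [bI] at h03
    exact (mul_eq_zero.1 (by linear_combination h03 / 8 :
      X ^ 2 * (sndProd p (conormal p)).imJ = 0)).resolve_left hX
  rw [bI, bJ, bK] at him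
  have hY : Y = 1 - X := by linarith
  refine mul_ne_zero hX (pow_ne_zero 2 hy) ?_
  rw [hY] at him ⊢
  linear_combination him

/-- The obstruction to a scalar square needs both coordinates nonzero. If one coordinate of `p`
vanishes, a small rotation of `p` towards `A_4 p = (y, -x)` makes both nonzero. -/
theorem exists_mem_sumSq_ne_zero {U : Set S7} (hU : IsOpen U) (hne : U.Nonempty) :
    ∃ p ∈ U, sumSq (p : QuaternionPlane).fst ≠ 0 ∧ sumSq (p : QuaternionPlane).snd ≠ 0 := by
  obtain ⟨p, hp⟩ := hne
  by_contra! hcon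
  let γ : ℝ → S7 := fun t =>
    ⟨Real.cos t • (p : QuaternionPlane) + Real.sin t • cliffordFrame 3 (p : QuaternionPlane), by
      rw [mem_sphere_zero_iff_norm, ← sq_eq_sq₀ (norm_nonneg _) zero_le_one, norm_add_sq_real,
        norm_smul, norm_smul, inner_smul_left, inner_smul_right,
        isSkewFrame_cliffordFrame.inner_self_apply, mul_pow, mul_pow, norm_eq_of_mem_sphere,
        ← real_inner_self_eq_norm_sq (cliffordFrame 3 (p : QuaternionPlane)),
        isSkewFrame_cliffordFrame.orthonormal, if_pos rfl, Real.norm_eq_abs, Real.norm_eq_abs,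
        sq_abs, sq_abs]
      linear_combination Real.cos_sq_add_sin_sq t⟩
  have hγ : Continuous γ := by
    refine Continuous.subtype_mk ?_ _
    fun_prop
  have hγ0 : γ 0 = p := Subtype.ext (by simp [γ])
  have hev : ∀ᶠ t in nhdsWithin (0 : ℝ) (Set.Ioi 0), γ t ∈ U ∧ t ∈ Set.Ioo (0 : ℝ) 1 := by
    refine Filter.Eventually.and ?_ (Ioo_mem_nhdsGT one_pos)
    exact (hγ.continuousAt.eventually_mem (by rw [hγ0]; exact hU.mem_nhds hp)).filter_mono
      nhdsWithin_le_nhds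
  obtain ⟨t, htU, ht0, ht1⟩ := hev.exists
  have hsin : Real.sin t ≠ 0 :=
    (Real.sin_pos_of_pos_of_lt_pi ht0 (by linarith [Real.pi_gt_three])).ne'
  have hcos : Real.cos t ≠ 0 := (Real.cos_pos_of_mem_Ioo
    ⟨by linarith [Real.pi_gt_three], by linarith [Real.pi_gt_three]⟩).ne'
  have h1 : (γ t : QuaternionPlane).fst =
      Real.cos t • (p : QuaternionPlane).fst + Real.sin t • (p : QuaternionPlane).snd := rfl
  have h2 : (γ t : QuaternionPlane).snd =
      Real.cos t • (p : QuaternionPlane).snd + Real.sin t • -(p : QuaternionPlane).fst := rfl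
  have hz : ∀ a : Quaternion ℝ, sumSq a = 0 ↔ a = 0 := fun a => by
    rw [sumSq_eq, sq_eq_zero_iff, norm_eq_zero]
  have hcase := hcon p hp
  have hcase' := hcon (γ t) htU
  have hsum := sumSq_add_sumSq p
  rw [h1, h2] at hcase'
  simp only [ne_eq, hz] at hcase hcase'
  by_cases hx : (p : QuaternionPlane).fst = 0
  · have hy : (p : QuaternionPlane).snd ≠ 0 := fun hy => by
      rw [(hz _).2 hx, (hz _).2 hy] at hsum
      norm_num at hsum
    rw [hx, smul_zero, zero_add, neg_zero, smul_zero, add_zero] at hcase'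
    exact smul_ne_zero hcos hy (hcase' (smul_ne_zero hsin hy))
  · rw [hcase hx, smul_zero, smul_zero, zero_add, add_zero] at hcase'
    exact smul_ne_zero hsin (neg_ne_zero.2 hx) (hcase' (smul_ne_zero hcos hx))

/-- The relation `J_Z ^ 2 = -c`, valid for every covector of the quaternionic structure, would be
transported to `conormal p` at a point where it fails. -/
theorem not_somewhereLocallyIsometric :
    ¬ quaternionic.SomewhereLocallyIsometric trivializable := by
  rw [quaternionic_eq, trivializable_eq]
  rintro ⟨φ, ⟨q₀, hq₀⟩, hφ⟩
  obtain ⟨p, hp, hx, hy⟩ := exists_mem_sumSq_ne_zero φ.open_target ⟨_, φ.map_source hq₀⟩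
  obtain ⟨q, hq, rfl⟩ : ∃ q ∈ φ.source, φ q = p :=
    ⟨_, φ.map_target hp, φ.right_inv hp⟩
  have ht := isSkewFrame_cliffordFrame.tangentPart_frameSpan (φ q)
  obtain ⟨L, hLmem, hLsurj, hLiso, hL⟩ := IsCurvatureAt.exists_linearMap_of_isIsometryAt φ hφ hq
    (isSkewFrame_hopfFrame.isCurvatureAt_frameSpan_orthogonal q)
    (isSkewFrame_cliffordFrame.isCurvatureAt_frameSpan (φ q))
  rw [ht] at hLmem hLsurj hL
  obtain ⟨ξ, hξq, -, -, hξ⟩ := hL _ (inner_conormal_of_mem (φ q))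
  obtain ⟨c, -, hc⟩ := exists_sq_frameOrthogonalCurvature_hopfFrame hξq
  refine not_exists_sq_frameCurvature hx hy c fun b hb => ?_
  obtain ⟨a, ha, rfl⟩ := hLsurj b hb
  obtain ⟨a', ha', hab⟩ := hc a ha
  refine ⟨L a', hLmem a' ha', fun b hb => ?_⟩
  obtain ⟨d, hd, rfl⟩ := hLsurj b hb
  rw [hξ a ha d hd, hξ a' ha' d hd, hLiso a' ha' d hd, hLiso a ha d hd]
  exact hab d

theorem exists_coe_eq (a b : Quaternion ℝ) (h : sumSq a + sumSq b = 1) :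
    ∃ p : S7, (p : QuaternionPlane).fst = a ∧ (p : QuaternionPlane).snd = b := by
  refine ⟨⟨WithLp.toLp 2 (a, b), ?_⟩, rfl, rfl⟩
  rw [mem_sphere_zero_iff_norm, ← sq_eq_sq₀ (norm_nonneg _) zero_le_one,
    ← real_inner_self_eq_norm_sq, inner_eq_sum_coords, fst_toLp, snd_toLp]
  simp only [sumSq] at h
  linear_combination h

/-- An isometry carrying the nonsingular point `(1, 0)` to a point with `|x| = |y|` would pull back
a degenerate form with nonzero conormal to a nondegenerate one. -/
theorem not_isPretransitive : ¬ MulAction.IsPretransitive trivializable.isometryGroup S7 := by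
  intro htr
  obtain ⟨q, hq1, hq2⟩ := exists_coe_eq (quat 1 0 0 0) (quat 0 0 0 0) (by simp [sumSq])
  obtain ⟨p, hp1, hp2⟩ := exists_coe_eq (quat (1 / 2) (1 / 2) 0 0) (quat (1 / 2) (1 / 2) 0 0)
    (by simp [sumSq]; norm_num)
  have hq : sumSq (q : QuaternionPlane).fst ≠ sumSq (q : QuaternionPlane).snd := by
    rw [hq1, hq2]
    simp [sumSq]
  have hp : sumSq (p : QuaternionPlane).fst = sumSq (p : QuaternionPlane).snd := by
    rw [hp1, hp2]
  obtain ⟨⟨e, Φ, rfl, hΦ⟩, hg⟩ := MulAction.exists_smul_eq trivializable.isometryGroup q p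
  have hΦq : Φ.toPartialDiffeomorph q = p := hg
  subst hΦq
  rw [trivializable_eq] at hΦ
  have ht := isSkewFrame_cliffordFrame.tangentPart_frameSpan
  obtain ⟨L, hLmem, hLsurj, -, hL⟩ := IsCurvatureAt.exists_linearMap_of_isIsometryAt
    Φ.toPartialDiffeomorph (fun q _ => hΦ q) (Set.mem_univ q)
    (isSkewFrame_cliffordFrame.isCurvatureAt_frameSpan q)
    (isSkewFrame_cliffordFrame.isCurvatureAt_frameSpan _)
  rw [ht, ht] at hLmem hLsurj hL
  obtain ⟨⟨b, hb, hb0, hker⟩, d, hd, e, he, hne⟩ := exists_kernel_frameCurvature hp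
  obtain ⟨ξ, hξq, hξH, hξ0, hξ⟩ := hL _ (inner_conormal_of_mem _)
  obtain ⟨a, ha, rfl⟩ := hLsurj b hb
  obtain ⟨a', ha', hne'⟩ := exists_inner_frameCurvature_ne_zero hq hξq hξH
    (hξ0 (fun h0 => hne (by rw [h0, inner_zero_left])) (inner_conormal _)) ha
    (fun h0 => hb0 (by rw [h0, map_zero]))
  rw [← hξ a ha a' ha'] at hne'
  exact hne' (hker _ (hLmem a' ha'))

end S7

end

theorem mainTheorem2 :
    ¬ S7.quaternionic.SomewhereLocallyIsometric S7.trivializable ∧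
    ¬ MulAction.IsPretransitive S7.trivializable.isometryGroup S7 ∧
    (∀ q : S7, S7.trivializable.NonsingularAt q ↔
      ‖(q : QuaternionPlane).fst‖ ≠ ‖(q : QuaternionPlane).snd‖) ∧
    (∀ q : S7, S7.quaternionic.NonsingularAt q) :=
  ⟨S7.not_somewhereLocallyIsometric, S7.not_isPretransitive, S7.trivializable_nonsingularAt_iff,
    S7.quaternionic_nonsingularAt⟩
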